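/- **Corollary 3.4.** Let $G=(U,V)$ be a finite simple bipartite graph with $|U|=|V|=n$, drawn in the plane without crossings (vertices are distinct points, edges are simple arcs that meet only in common end points), and let every edge $e$ of $G$ carry a weight $\omega_e$ in a commutative ring (for example a real number or an indeterminate). For a subgraph $H$ of $G$ let $M(H)=\sum_P\prod_{e\in P}\omega_e$, where $P$ runs over all perfect matchings of $H$. For sets $X$ of vertices and $S$ of edges, $G-X$ is obtained by deleting the vertices in $X$ together with all incident edges, and $G-X-S$ by then deleting the edges in $S$ that are still present. Let $2\le k\le n$, and let $e_1=a_1b_1,\ \dots,\ e_k=a_kb_k$ be pairwise disjoint edges of $G$ with $a_i\in U$ and $b_i\in V$ for all $i$, all lying in the boundary of one face $f$ of $G$ (a connected component of the complement of the drawing). Suppose that $a_1,b_1,a_2,b_2,\dots,a_k,b_k$ appear in this cyclic order (clockwise or counterclockwise) on $f$; that is, from some point of $f$ one can draw simple arcs to these vertices that run inside $f$ up to their end points, meet pairwise only in the starting point, and leave it as straight segments in this cyclic order. Write $[k]=\{1,\dots,k\}$ and $E_I=\{e_t : t\in I\}$ for $I\subseteq[k]$. Then for every $j\in[k]$, $$M(G)\,M(G-E_{[k]})=M(G-e_j)\,M(G-E_{[k]\setminus\{j\}})+\sum_{\substack{1\le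 i\le k\\ i\ne j}}\omega_{e_i}\,\omega_{e_j}\,M(G-a_i-b_j)\,M(G-a_j-b_i-E_{[k]\setminus\{i,j\}}).$$ -/

import Mathlib

open scoped Real unitInterval

/-- A set of edges `P` of the graph `H` is a perfect matching of `H` if every vertex of `H` lies on
exactly one edge of `P`. The graph `H` is given as a subgraph of an ambient graph `G`. -/
def IsPerfectMatchingOf {W : Type*} {G : SimpleGraph W} (H : G.Subgraph)
    (P : Finset (Sym2 W)) : Prop :=
  (∀ e ∈ P, e ∈ H.edgeSet) ∧ ∀ v ∈ H.verts, ∃! e : Sym2 W, e ∈ P ∧ v ∈ e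

open Classical in
/-- `M(H)`: the sum over all perfect matchings of `H` of the product of the weights of their
edges. -/
noncomputable def matchingSum {W R : Type*} [Fintype W] [CommRing R] {G : SimpleGraph W}
    (ω : Sym2 W → R) (H : G.Subgraph) : R :=
  ∑ P : Finset (Sym2 W) with IsPerfectMatchingOf H P, ∏ e ∈ P, ω e

/-- A drawing of `G` in the plane `ℂ` without crossings: the vertices are distinct points, every
edge is a simple arc joining its end points (given once for each of the two directions in which the
edge can be traversed), an arc contains no vertex besides its end points, and two different edges
meet only in common end points. -/
structure PlaneDrawing {W : Type*} (G : SimpleGraph W) where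
  pos : W → ℂ
  pos_injective : Function.Injective pos
  arc : (d : G.Dart) → Path (pos d.fst) (pos d.snd)
  arc_injective : ∀ d, Function.Injective (arc d)
  arc_symm : ∀ d, arc d.symm = (arc d).symm
  pos_mem_arc : ∀ d v, pos v ∈ Set.range (arc d) → v ∈ d.edge
  arc_inter_arc : ∀ d d', d.edge ≠ d'.edge → ∀ z ∈ Set.range (arc d) ∩ Set.range (arc d'),
    ∃ v, v ∈ d.edge ∧ v ∈ d'.edge ∧ pos v = z

namespace PlaneDrawing

variable {W : Type*} {G : SimpleGraph W} (D : PlaneDrawing G)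

/-- The point set of the drawing: all vertices and all points of edges. -/
def carrier : Set ℂ :=
  Set.range D.pos ∪ ⋃ d, Set.range (D.arc d)

/-- A face is a connected component of the complement of the drawing. -/
def IsFace (f : Set ℂ) : Prop :=
  ∃ z ∈ D.carrierᶜ, f = connectedComponentIn D.carrierᶜ z

/-- The edge underlying `d` lies in the boundary of the face `f`. -/
def EdgeOnBoundary (f : Set ℂ) (d : G.Dart) : Prop :=
  Set.range (D.arc d) ⊆ frontier f

/-- The vertices `p i`, taken in the order of the index set `ι`, appear in this cyclic order
(clockwise or counterclockwise) on the face `f`: from some point `c` of `f` one can draw simple arcs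
to them which run inside `f` up to their last point, pairwise meet only in `c`, and leave `c` (as
straight segments, in the directions `exp (θ i * I)`) in this cyclic order. For a face with a
connected boundary this is the cyclic order along its boundary walk; the formulation also makes
sense when the boundary is disconnected, or passes several times through a vertex. -/
def InCyclicOrder {ι : Type*} [LinearOrder ι] (f : Set ℂ) (p : ι → W) : Prop :=
  ∃ (c : ℂ) (γ : (i : ι) → Path c (D.pos (p i))) (θ : ι → ℝ) (δ : ℝ),
    c ∈ f ∧
    (∀ i, Function.Injective (γ i)) ∧
    (∀ i (t : I), t ≠ 1 → γ i t ∈ f) ∧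
    (∀ i j, i ≠ j → ∀ s t : I, γ i s = γ j t → s = 0 ∧ t = 0) ∧
    0 < δ ∧
    (∀ i (t : I), (t : ℝ) ≤ δ → γ i t = c + (t : ℝ) * Complex.exp (θ i * Complex.I)) ∧
    (StrictMono θ ∨ StrictAnti θ) ∧
    ∀ i j, θ i - θ j < 2 * π

end PlaneDrawing

/-- The sequence `a₁, b₁, a₂, b₂, …, aₖ, bₖ`, indexed by the lexicographically ordered pairs. -/
def alternating {W : Type*} {k : ℕ} (a b : Fin k → W) : Fin k ×ₗ Fin 2 → W :=
  fun x => if (ofLex x).2 = 0 then a (ofLex x).1 else b (ofLex x).1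

/-! Perfect matchings are bijections `U ≃ V` along edges, and each product of two matching sums is a
sum over pairs `(P, Q)`. The cycles of the permutation `P⁻¹ Q` of `U` are the alternating cycles of
the superposition of `P` and `Q`; exchanging `P` and `Q` along one cycle preserves the weight.

On the left `Q` contains no `e_t`. The pairs with `e_j ∉ P` also occur in the first product on the
right and cancel. There remain the pairs with `e_j ∈ P` on the left (`IsFirstOnly`), and on the
right those with `e_j ∈ Q` only. Exchange along the cycle of `a_j` turns the latter into exactly
those remaining left pairs whose cycle through `a_j` has no other `e_t` in `P`. For any other left
pair, let `e_i` be the first such edge met from `a_j` on. Replace `e_i, e_j` in `P` by the virtual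
edges `a_i b_j` and `a_j b_i`; this splits the cycle between `a_j` and `a_i`. Exchanging along the
part with `a_j` moves `a_j b_i` into `Q`, which gives the term of index `i`.

These maps are bijective by planarity. If a cycle contained `e_j` from `P` and `e_i` from `Q`
(`NoOpposite`), or both virtual edges (`NoVirtual`), then removing these two edges would leave
disjoint walks joining `a_i` to `a_j` and `b_i` to `b_j`. These pairs interlace on the face, so
closing the walks through the common point of the face gives two loops that cross there and meet
nowhere else. That is impossible (`not_crossing_once`): a continuous logarithm of `J s - K t` would
have total variation `2π` where it must vanish. -/

/-! ### Two loops cannot cross exactly once -/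

/-- A continuous function on a preconnected set is constant if its exponential is. -/
lemma Complex.eq_of_exp_comp_eq {X : Type*} [TopologicalSpace X] {s : Set X}
    (hs : IsPreconnected s) {g : X → ℂ} (hg : ContinuousOn g s)
    (he : ∀ a ∈ s, ∀ a' ∈ s, Complex.exp (g a) = Complex.exp (g a'))
    {a a' : X} (ha : a ∈ s) (ha' : a' ∈ s) : g a = g a' :=
  Complex.isCoveringMap_exp.constOn_of_comp hs hg
    (fun x hx y hy => Subtype.ext (he x hx y hy)) ha ha'

/-- The variation of a continuous logarithm along a segment between two points whose arguments
differ by less than `π`. -/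
lemma im_log_variation_segment {g : ℝ → ℂ} (hg : ContinuousOn g (Set.Icc 0 1))
    {r r' α β : ℝ} (hr : 0 < r) (hr' : 0 < r') (h1 : α - β < π) (h2 : -π < α - β)
    (he : ∀ τ ∈ Set.Icc (0 : ℝ) 1, Complex.exp (g τ) =
      τ * (r * Complex.exp (α * Complex.I)) + (1 - τ) * (r' * Complex.exp (β * Complex.I))) :
    (g 1 - g 0).im = α - β := by
  set φ := α - β with hφ
  -- The segment rotated by `-β`: it ends on the positive real axis and avoids the slit, so the
  -- principal logarithm is continuous along it and differs from `g` by a constant.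
  let z : ℝ → ℂ := fun τ => τ * (r * Complex.exp (φ * Complex.I)) + (1 - τ) * r'
  have hz : ∀ τ ∈ Set.Icc (0 : ℝ) 1, z τ ∈ Complex.slitPlane := by
    intro τ hτ
    have hzr : (z τ).re = τ * r * Real.cos φ + (1 - τ) * r' := by
      simp [z, Complex.exp_re, Complex.exp_im]; ring
    have hzi : (z τ).im = τ * r * Real.sin φ := by
      simp [z, Complex.exp_re, Complex.exp_im]; ring
    rw [Complex.mem_slitPlane_iff, hzr, hzi]
    by_cases hs : Real.sin φ = 0
    · left
      have h0 : φ = 0 := by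
        rcases lt_trichotomy φ 0 with h | h | h
        · exact absurd hs (Real.sin_neg_of_neg_of_neg_pi_lt h h2).ne
        · exact h
        · exact absurd hs (Real.sin_pos_of_pos_of_lt_pi h h1).ne'
      rw [h0, Real.cos_zero]
      rcases eq_or_lt_of_le hτ.1 with h | h
      · rw [← h]; simpa using hr'
      · have := mul_nonneg (sub_nonneg.2 hτ.2) hr'.le
        have := mul_pos h hr
        linarith
    · rcases eq_or_lt_of_le hτ.1 with h | h
      · left; rw [← h]; simpa using hr'
      · right; exact mul_ne_zero (mul_pos h hr).ne' hs
  have hzc : ContinuousOn (fun τ => Complex.log (z τ)) (Set.Icc 0 1) :=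
    ContinuousOn.clog (by fun_prop) hz
  have key : g 1 - Complex.log (z 1) = g 0 - Complex.log (z 0) := by
    have hE : ∀ τ ∈ Set.Icc (0 : ℝ) 1, Complex.exp (g τ - Complex.log (z τ)) =
        Complex.exp (β * Complex.I) := by
      intro τ hτ
      have hne := Complex.slitPlane_ne_zero (hz τ hτ)
      rw [Complex.exp_sub, Complex.exp_log hne, he τ hτ, div_eq_iff hne]
      simp only [z, hφ]
      have : Complex.exp (α * Complex.I) =
          Complex.exp (β * Complex.I) * Complex.exp (((α - β : ℝ) : ℂ) * Complex.I) := by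
        rw [← Complex.exp_add]; congr 1; push_cast; ring
      rw [this]; ring
    exact Complex.eq_of_exp_comp_eq (g := fun τ => g τ - Complex.log (z τ))
      (isPreconnected_Icc (a := (0 : ℝ)) (b := 1)) (hg.sub hzc)
      (fun a ha b hb => (hE a ha).trans (hE b hb).symm) (by simp) (by simp)
  have h10 : g 1 - g 0 = Complex.log (z 1) - Complex.log (z 0) := by
    linear_combination key
  have e1 : z 1 = r * Complex.exp (φ * Complex.I) := by simp [z]
  have e0 : z 0 = r' := by simp [z]
  rw [h10, Complex.sub_im, Complex.log_im, Complex.log_im, e1, e0, Complex.arg_ofReal_of_nonneg hr'.le,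
    Complex.arg_real_mul _ hr, Complex.arg_exp_mul_I, toIocMod_eq_self Real.two_pi_pos |>.2]
  · simp
  · constructor <;> linarith

/-- The plane without the four closed quadrants that touch the unit square in a corner. -/
def plusShape : Set (ℝ × ℝ) := {x | x.1 ∈ Set.Ioo (0 : ℝ) 1 ∨ x.2 ∈ Set.Ioo (0 : ℝ) 1}

lemma isOpen_plusShape : IsOpen plusShape :=
  (isOpen_Ioo.preimage continuous_fst).union (isOpen_Ioo.preimage continuous_snd)

/-- The shape is star-shaped about the centre of the square, so a nowhere vanishing function on it
has a continuous logarithm. The corners, where both curves sit in the base point, are left out. -/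
lemma isSimplyConnected_plusShape : IsSimplyConnected plusShape := by
  have hm : ((1 / 2, 1 / 2) : ℝ × ℝ) ∈ plusShape := by left; norm_num
  have hstar : StarConvex ℝ ((1 / 2, 1 / 2) : ℝ × ℝ) plusShape := by
    have hI : StarConvex ℝ (1 / 2 : ℝ) (Set.Ioo (0 : ℝ) 1) :=
      (convex_Ioo 0 1).starConvex (by norm_num)
    intro y hy a b ha hb hab
    rcases hy with hy | hy
    · exact Or.inl (hI hy ha hb hab)
    · exact Or.inr (hI hy ha hb hab)
  have := hstar.contractibleSpace ⟨_, hm⟩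
  exact inferInstanceAs (SimplyConnectedSpace plusShape)

/-- Two closed curves that cross each other in a common base point, which they pass along straight
segments, have a further common point. -/
theorem not_crossing_once {J K : ℝ → ℂ} (hJ : Continuous J) (hK : Continuous K)
    {c : ℂ} {ε : ℝ} (hε : 0 < ε) (hε' : ε < 1) {r₁ r₂ r₃ r₄ θ₁ θ₂ θ₃ θ₄ : ℝ}
    (hr₁ : 0 < r₁) (hr₂ : 0 < r₂) (hr₃ : 0 < r₃) (hr₄ : 0 < r₄)
    (h12 : θ₁ < θ₂) (h23 : θ₂ < θ₃) (h34 : θ₃ < θ₄) (h41 : θ₄ - θ₁ < 2 * π)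
    (hJ0 : ∀ s ∈ Set.Icc 0 ε, J s = c + s * (r₁ * Complex.exp (θ₁ * Complex.I)))
    (hJ1 : ∀ s ∈ Set.Icc 0 ε, J (1 - s) = c + s * (r₃ * Complex.exp (θ₃ * Complex.I)))
    (hK0 : ∀ s ∈ Set.Icc 0 ε, K s = c + s * (r₂ * Complex.exp (θ₂ * Complex.I)))
    (hK1 : ∀ s ∈ Set.Icc 0 ε, K (1 - s) = c + s * (r₄ * Complex.exp (θ₄ * Complex.I)))
    (hne : ∀ x ∈ plusShape, J x.1 ≠ K x.2) : False := by
  obtain ⟨f, hf, hexp⟩ := Complex.exists_continuousOn_eqOn_exp_comp isSimplyConnected_plusShape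
    isOpen_plusShape (g := fun x => J x.1 - K x.2) (by fun_prop)
    (by rintro ⟨x, hx, h⟩; exact hne x hx (sub_eq_zero.1 h))
  have hexp' : ∀ s t : ℝ, (s, t) ∈ plusShape → Complex.exp (f (s, t)) = J s - K t :=
    fun s t h => hexp h
  have e0 : (0 : ℝ) ∈ Set.Icc 0 ε := ⟨le_rfl, hε.le⟩
  have J0 : J 0 = c := by simpa using hJ0 0 e0
  have J1 : J 1 = c := by simpa using hJ1 0 e0
  have K0 : K 0 = c := by simpa using hK0 0 e0
  have K1 : K 1 = c := by simpa using hK1 0 e0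
  have eI : ε ∈ Set.Ioo (0 : ℝ) 1 := ⟨hε, hε'⟩
  have eI' : 1 - ε ∈ Set.Ioo (0 : ℝ) 1 := ⟨by linarith, by linarith⟩
  -- opposite sides of the square carry the same function
  have hv : f (1, ε) - f (0, ε) = f (1, 1 - ε) - f (0, 1 - ε) := by
    have hc : ∀ s : ℝ, ContinuousOn (fun t : ℝ => f (s, t)) (Set.Ioo 0 1) := fun s =>
      hf.comp (by fun_prop) (fun t ht => Or.inr ht)
    refine Complex.eq_of_exp_comp_eq (g := fun t : ℝ => f (1, t) - f (0, t))
      (isPreconnected_Ioo (a := (0 : ℝ)) (b := 1)) ((hc 1).sub (hc 0)) ?_ eI eI'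
    have : ∀ t ∈ Set.Ioo (0 : ℝ) 1, Complex.exp (f (1, t) - f (0, t)) = 1 := by
      intro t ht
      rw [Complex.exp_sub, hexp' 1 t (Or.inr ht), hexp' 0 t (Or.inr ht), J0, J1]
      refine div_self (sub_ne_zero.2 ?_)
      have := hne (0, t) (Or.inr ht)
      rwa [J0] at this
    exact fun a ha b hb => (this a ha).trans (this b hb).symm
  have hh : f (ε, 1) - f (ε, 0) = f (1 - ε, 1) - f (1 - ε, 0) := by
    have hc : ∀ t : ℝ, ContinuousOn (fun s : ℝ => f (s, t)) (Set.Ioo 0 1) := fun s =>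
      hf.comp (by fun_prop) (fun t ht => Or.inl ht)
    refine Complex.eq_of_exp_comp_eq (g := fun t : ℝ => f (t, 1) - f (t, 0))
      (isPreconnected_Ioo (a := (0 : ℝ)) (b := 1)) ((hc 1).sub (hc 0)) ?_ eI eI'
    have : ∀ t ∈ Set.Ioo (0 : ℝ) 1, Complex.exp (f (t, 1) - f (t, 0)) = 1 := by
      intro t ht
      rw [Complex.exp_sub, hexp' t 1 (Or.inl ht), hexp' t 0 (Or.inl ht), K0, K1]
      refine div_self (sub_ne_zero.2 ?_)
      have := hne (t, 0) (Or.inl ht)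
      rwa [K0] at this
    exact fun a ha b hb => (this a ha).trans (this b hb).symm
  have hexpI : ∀ (θ : ℝ), -Complex.exp (θ * Complex.I) =
      Complex.exp (((θ + π : ℝ) : ℂ) * Complex.I) ∧ -Complex.exp (θ * Complex.I) =
      Complex.exp (((θ - π : ℝ) : ℂ) * Complex.I) := by
    intro θ
    constructor <;> push_cast <;> simp [add_mul, sub_mul, Complex.exp_add, Complex.exp_sub, div_neg]
  -- the variation of the logarithm across a corner
  have corner : ∀ (S T : ℝ → ℝ) (r r' θ θ' β : ℝ), Continuous S → Continuous T → 0 < r → 0 < r' →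
      (∀ s ∈ Set.Icc 0 ε, J (S s) = c + s * (r * Complex.exp (θ * Complex.I))) →
      (∀ s ∈ Set.Icc 0 ε, K (T s) = c + s * (r' * Complex.exp (θ' * Complex.I))) →
      (∀ s ∈ Set.Ioo (0 : ℝ) 1, S s ∈ Set.Ioo (0 : ℝ) 1 ∧ T s ∈ Set.Ioo (0 : ℝ) 1) →
      -Complex.exp (θ' * Complex.I) = Complex.exp (β * Complex.I) → θ - β < π → -π < θ - β →
      (f (S ε, T 0)).im - (f (S 0, T ε)).im = θ - β := by
    intro S T r r' θ θ' β hS hT hr hr' hJS hKT hST hβ h1 h2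
    have hmem : ∀ τ ∈ Set.Icc (0 : ℝ) 1, (S (ε * τ), T (ε * (1 - τ))) ∈ plusShape := by
      intro τ hτ
      rcases eq_or_lt_of_le hτ.1 with h | h
      · right
        rw [← h]; simpa using (hST ε eI).2
      · left
        exact (hST _ ⟨mul_pos hε h, by nlinarith [hτ.2]⟩).1
    have := im_log_variation_segment (g := fun τ => f (S (ε * τ), T (ε * (1 - τ))))
      (hf.comp (by fun_prop) hmem) (mul_pos hε hr) (mul_pos hε hr') h1 h2 (by
        intro τ hτ
        have m1 : ε * τ ∈ Set.Icc 0 ε := ⟨mul_nonneg hε.le hτ.1, by nlinarith [hτ.2]⟩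
        have m2 : ε * (1 - τ) ∈ Set.Icc 0 ε :=
          ⟨mul_nonneg hε.le (by linarith [hτ.2]), by nlinarith [hτ.1]⟩
        rw [hexp' _ _ (hmem τ hτ), hJS _ m1, hKT _ m2, ← hβ]
        push_cast; ring)
    simpa using this
  have hid : ∀ s ∈ Set.Ioo (0 : ℝ) 1, 1 - s ∈ Set.Ioo (0 : ℝ) 1 := fun s hs =>
    ⟨by linarith [hs.2], by linarith [hs.1]⟩
  -- The angle of the opposite ray is taken as `θ' - π` or `θ' + π`, whichever differs from `θ` by
  -- less than `π`. Only the second corner needs `+ π`; this asymmetry is the source of the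
  -- contradiction.
  have c1 := corner id id r₁ r₂ θ₁ θ₂ (θ₂ - π) continuous_id continuous_id hr₁ hr₂ hJ0 hK0
    (fun s hs => ⟨hs, hs⟩) (hexpI θ₂).2 (by linarith) (by linarith)
  have c2 := corner (fun s => 1 - s) id r₃ r₂ θ₃ θ₂ (θ₂ + π) (by fun_prop) continuous_id hr₃ hr₂
    hJ1 hK0 (fun s hs => ⟨hid s hs, hs⟩) (hexpI θ₂).1 (by linarith) (by linarith)
  have c3 := corner (fun s => 1 - s) (fun s => 1 - s) r₃ r₄ θ₃ θ₄ (θ₄ - π) (by fun_prop)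
    (by fun_prop) hr₃ hr₄
    hJ1 hK1 (fun s hs => ⟨hid s hs, hid s hs⟩) (hexpI θ₄).2 (by linarith) (by linarith)
  have c4 := corner id (fun s => 1 - s) r₁ r₄ θ₁ θ₄ (θ₄ - π) continuous_id
    (by fun_prop) hr₁ hr₄
    hJ0 hK1 (fun s hs => ⟨hs, hid s hs⟩) (hexpI θ₄).2 (by linarith) (by linarith)
  simp only [id, sub_zero] at c1 c2 c3 c4
  have hv' := congrArg Complex.im hv
  have hh' := congrArg Complex.im hh
  simp only [Complex.sub_im] at hv' hh'
  -- In `c1 - c2 + c3 - c4` the left sides cancel by `hv'` and `hh'`, and the angles cancel on the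
  -- right, which leaves `0 = 2π`.
  linarith [Real.pi_pos]

/-- Joining the end points of two paths that start in `c` gives a loop at `c`. -/
lemma exists_loop {X : Type*} [TopologicalSpace X] {c x y : X} (γ : Path c x) (γ' : Path c y)
    {A : Set X} (h : JoinedIn A x y) :
    ∃ J : ℝ → X, Continuous J ∧ (∀ t : I, J (t / 4) = γ t) ∧ (∀ t : I, J (1 - t / 4) = γ' t) ∧
      (∀ s, (∃ u, J s = γ u) ∨ (∃ u, J s = γ' u) ∨ J s ∈ A) ∧
      ∀ s ∈ Set.Ioo (0 : ℝ) 1,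
        (∃ u, u ≠ 0 ∧ J s = γ u) ∨ (∃ u, u ≠ 0 ∧ J s = γ' u) ∨ J s ∈ A := by
  obtain ⟨P, hP⟩ := h
  -- Out along `γ` at speed 4, across along `P`, and back along `γ'` at speed 4. Outside `[0, 1]`
  -- the curve rests in `c`.
  let J : ℝ → X := fun s => if s ≤ 1 / 4 then γ.extend (4 * s) else
    if s ≤ 3 / 4 then P.extend (2 * s - 1 / 2) else γ'.extend (4 * (1 - s))
  have hPe : ∀ s, P.extend s ∈ A := by
    intro s
    have : P.extend s ∈ Set.range P := by rw [← P.extend_range]; exact ⟨s, rfl⟩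
    obtain ⟨t, ht⟩ := this
    rw [← ht]; exact hP t
  have hext : ∀ {z : X} (g : Path c z) (s : ℝ), ∃ u, g.extend s = g u := fun g s =>
    ⟨Set.projIcc 0 1 zero_le_one s, rfl⟩
  have hext' : ∀ {z : X} (g : Path c z) (s : ℝ), 0 < s → ∃ u, u ≠ 0 ∧ g.extend s = g u := by
    intro z g s hs
    refine ⟨Set.projIcc 0 1 zero_le_one s, ?_, rfl⟩
    intro h0
    have := congrArg Subtype.val h0
    simp only [Set.projIcc, Set.Icc.coe_zero] at this
    rcases max_choice 0 (min 1 s) with h | h <;> rcases min_choice 1 s with h' | h' <;>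
      simp_all
    linarith
  refine ⟨J, ?_, ?_, ?_, ?_, ?_⟩
  · refine Continuous.if_le (by fun_prop) (Continuous.if_le (by fun_prop) (by fun_prop)
      continuous_id continuous_const ?_) continuous_id continuous_const ?_
    · rintro s rfl
      norm_num
    · rintro s rfl
      norm_num
  · intro t
    have ht := t.2
    have h1 : (t : ℝ) / 4 ≤ 1 / 4 := by linarith [ht.2]
    simp only [J, if_pos h1]
    rw [mul_div_cancel₀ (t : ℝ) (by norm_num : (4 : ℝ) ≠ 0), Path.extend_extends']
  · intro t
    have ht := t.2
    have h1 : ¬ 1 - (t : ℝ) / 4 ≤ 1 / 4 := by linarith [ht.2]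
    simp only [J, if_neg h1]
    split_ifs with h2
    · have h3 : t = 1 := Subtype.ext (le_antisymm ht.2 (by simp only [Set.Icc.coe_one]; linarith))
      subst h3
      norm_num
    · rw [show 4 * (1 - (1 - (t : ℝ) / 4)) = t by ring, Path.extend_extends']
  · intro s
    simp only [J]
    split_ifs
    · exact Or.inl (hext _ _)
    · exact Or.inr (Or.inr (hPe _))
    · exact Or.inr (Or.inl (hext _ _))
  · intro s hs
    simp only [J]
    split_ifs
    · exact Or.inl (hext' _ _ (by linarith [hs.1]))
    · exact Or.inr (Or.inr (hPe _))
    · exact Or.inr (Or.inl (hext' _ _ (by linarith [hs.2])))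

/-! ### Disjoint walks in a plane drawing -/

/-- `x` and `y` are joined by a walk whose vertices lie in `S`. -/
def JoinedInside {W : Type*} (G : SimpleGraph W) (S : Set W) (x y : W) : Prop :=
  ∃ p : G.Walk x y, ∀ v ∈ p.support, v ∈ S

namespace JoinedInside

variable {W : Type*} {G : SimpleGraph W} {S : Set W} {x y z : W}

lemma refl (hx : x ∈ S) : JoinedInside G S x x := ⟨.nil, by simpa using hx⟩

lemma trans (h : JoinedInside G S x y) (h' : JoinedInside G S y z) : JoinedInside G S x z := by
  obtain ⟨p, hp⟩ := h
  obtain ⟨q, hq⟩ := h'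
  exact ⟨p.append q, fun v hv => ((SimpleGraph.Walk.mem_support_append_iff p q).1 hv).elim
    (hp v) (hq v)⟩

lemma symm (h : JoinedInside G S x y) : JoinedInside G S y x := by
  obtain ⟨p, hp⟩ := h
  exact ⟨p.reverse, fun v hv => hp v (by simpa using hv)⟩

lemma of_adj (h : G.Adj x y) (hx : x ∈ S) (hy : y ∈ S) : JoinedInside G S x y :=
  ⟨h.toWalk, by simp [hx, hy]⟩

end JoinedInside

namespace PlaneDrawing

variable {W : Type*} {G : SimpleGraph W} (D : PlaneDrawing G)

/-- The part of the drawing that belongs to the subgraph induced on `S`. -/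
def part (S : Set W) : Set ℂ :=
  D.pos '' S ∪ ⋃ (d : G.Dart) (_ : d.fst ∈ S ∧ d.snd ∈ S), Set.range (D.arc d)

lemma part_subset_carrier (S : Set W) : D.part S ⊆ D.carrier := by
  refine Set.union_subset_union (Set.image_subset_range _ _) ?_
  exact Set.iUnion_mono fun d => Set.iUnion_subset fun _ => subset_rfl

lemma mem_of_mem_edge {d : G.Dart} {S : Set W} (h : d.fst ∈ S ∧ d.snd ∈ S) {v : W}
    (hv : v ∈ d.edge) : v ∈ S := by
  obtain ⟨⟨x, y⟩, hd⟩ := d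
  simp only [SimpleGraph.Dart.edge, Sym2.mem_iff] at hv
  rcases hv with rfl | rfl
  exacts [h.1, h.2]

lemma pos_mem_part {S : Set W} {v : W} : D.pos v ∈ D.part S ↔ v ∈ S := by
  constructor
  · rintro (⟨w, hw, h⟩ | h)
    · rwa [← D.pos_injective h]
    · simp only [Set.mem_iUnion] at h
      obtain ⟨d, ⟨h1, h2⟩, h⟩ := h
      exact mem_of_mem_edge ⟨h1, h2⟩ (D.pos_mem_arc d v h)
  · exact fun h => Or.inl ⟨v, h, rfl⟩

lemma disjoint_part {S T : Set W} (h : Disjoint S T) : Disjoint (D.part S) (D.part T) := by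
  rw [Set.disjoint_left] at h ⊢
  rintro z (⟨v, hv, rfl⟩ | hz) hz'
  · exact h hv (D.pos_mem_part.1 hz')
  · rcases hz' with ⟨v, hv, rfl⟩ | hz'
    · exact h (D.pos_mem_part.1 (Or.inr hz)) hv
    · simp only [Set.mem_iUnion] at hz hz'
      obtain ⟨d, hd, hz⟩ := hz
      obtain ⟨d', hd', hz'⟩ := hz'
      by_cases he : d.edge = d'.edge
      · have hm : d.fst ∈ d.edge := Sym2.mem_mk_left _ _
        exact h hd.1 (mem_of_mem_edge hd' (he ▸ hm))
      · obtain ⟨v, h1, h2, -⟩ := D.arc_inter_arc d d' he z ⟨hz, hz'⟩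
        exact h (mem_of_mem_edge hd h1) (mem_of_mem_edge hd' h2)

lemma joinedIn_part {S : Set W} {x y : W} (h : JoinedInside G S x y) :
    JoinedIn (D.part S) (D.pos x) (D.pos y) := by
  obtain ⟨p, hp⟩ := h
  induction p with
  | nil => exact JoinedIn.refl (D.pos_mem_part.2 (hp _ (by simp)))
  | @cons u v w h p ih =>
    refine JoinedIn.trans ⟨D.arc ⟨(u, v), h⟩, fun t => Or.inr ?_⟩
      (ih fun x hx => hp x (by simp [hx]))
    simp only [Set.mem_iUnion]
    exact ⟨⟨(u, v), h⟩, ⟨hp _ (by simp), hp _ (by simp)⟩, t, rfl⟩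

lemma IsFace.subset {f : Set ℂ} (hf : D.IsFace f) : f ⊆ D.carrierᶜ := by
  obtain ⟨z, -, rfl⟩ := hf
  exact connectedComponentIn_subset _ _

/-- In a plane drawing, there are no two disjoint walks between interlacing pairs of vertices of one
face. -/
theorem not_joinedInside_interlaced {ι : Type*} [LinearOrder ι] {f : Set ℂ} (hf : D.IsFace f)
    {p : ι → W} (hp : D.InCyclicOrder f p) {i₁ i₂ i₃ i₄ : ι} (h12 : i₁ < i₂) (h23 : i₂ < i₃)
    (h34 : i₃ < i₄) {S T : Set W} (hST : Disjoint S T) (hS : JoinedInside G S (p i₁) (p i₃))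
    (hT : JoinedInside G T (p i₂) (p i₄)) : False := by
  obtain ⟨c, γ, θ, δ, -, -, hγf, hγ, hδ, hstr, hmono, hθ⟩ := hp
  have key : ∀ (j₁ j₂ j₃ j₄ : ι) (S T : Set W), θ j₁ < θ j₂ → θ j₂ < θ j₃ → θ j₃ < θ j₄ →
      Disjoint S T → JoinedInside G S (p j₁) (p j₃) → JoinedInside G T (p j₂) (p j₄) → False := by
    clear hST hS hT S T
    intro j₁ j₂ j₃ j₄ S T h12 h23 h34 hST hS hT
    have hcross : ∀ (i j : ι), θ i ≠ θ j → ∀ u v : I, u ≠ 0 ∨ v ≠ 0 → γ i u ≠ γ j v := by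
      intro i j hij u v huv h
      have := hγ i j (fun h => hij (h ▸ rfl)) u v h
      tauto
    have hcommon : ∀ (i j : ι), θ i ≠ θ j → ∀ u v : I, γ i u = γ j v → γ i u = c := by
      intro i j hij u v h
      by_cases hu : u = 0
      · rw [hu, (γ i).source]
      · exact absurd h (hcross i j hij u v (Or.inl hu))
    have hpart : ∀ (A : Set W) (i : ι) (u : I), p i ∉ A → γ i u ∉ D.part A := by
      intro A i u hi h
      by_cases hu : u = 1
      · rw [hu, (γ i).target] at h
        exact hi (D.pos_mem_part.1 h)
      · exact hf.subset D (hγf i u hu) (D.part_subset_carrier A h)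
    have hmemS : p j₁ ∈ S ∧ p j₃ ∈ S := by
      obtain ⟨q, hq⟩ := hS
      exact ⟨hq _ q.start_mem_support, hq _ q.end_mem_support⟩
    have hmemT : p j₂ ∈ T ∧ p j₄ ∈ T := by
      obtain ⟨q, hq⟩ := hT
      exact ⟨hq _ q.start_mem_support, hq _ q.end_mem_support⟩
    rw [Set.disjoint_left] at hST
    obtain ⟨J, hJc, hJ0, hJ1, hJ, hJ'⟩ := exists_loop (γ j₁) (γ j₃) (D.joinedIn_part hS)
    obtain ⟨K, hKc, hK0, hK1, hK, hK'⟩ := exists_loop (γ j₂) (γ j₄) (D.joinedIn_part hT)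
    -- The loops run along the arcs at speed 4 up to parameter `1 / 4`, and the arcs are straight up
    -- to `δ`.
    have hε : 0 < min (δ / 4) (1 / 4) := by positivity
    have hstr' : ∀ (i : ι) (F : ℝ → ℂ), (∀ t : I, F (t / 4) = γ i t) →
        ∀ s ∈ Set.Icc 0 (min (δ / 4) (1 / 4)),
          F s = c + s * ((4 : ℝ) * Complex.exp (θ i * Complex.I)) := by
      intro i F hF s hs
      have h1 := hs.2.trans (min_le_left _ _)
      have h2 := hs.2.trans (min_le_right _ _)
      have h3 := hF ⟨4 * s, by linarith [hs.1], by linarith⟩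
      rw [hstr i _ (by simp only; linarith)] at h3
      simp only [mul_div_cancel_left₀ s (by norm_num : (4 : ℝ) ≠ 0)] at h3
      rw [h3]; push_cast; ring
    refine not_crossing_once hJc hKc hε ((min_le_right _ _).trans_lt (by norm_num))
      four_pos four_pos four_pos four_pos h12 h23 h34 (hθ _ _) (hstr' _ J hJ0)
      (hstr' _ (fun s => J (1 - s)) hJ1) (hstr' _ K hK0) (hstr' _ (fun s => K (1 - s)) hK1) ?_
    have n12 : θ j₁ ≠ θ j₂ := by intro h; linarith
    have n14 : θ j₁ ≠ θ j₄ := by intro h; linarith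
    have n32 : θ j₃ ≠ θ j₂ := by intro h; linarith
    have n34 : θ j₃ ≠ θ j₄ := by intro h; linarith
    rintro ⟨s, t⟩ hst heq
    simp only at heq
    have hdis := Set.disjoint_left.1 (D.disjoint_part (Set.disjoint_left.2 hST))
    -- The loops can meet only in `c`: distinct arcs share only `c`, the two parts of the drawing
    -- are disjoint, and an arc meets the drawing only in its end vertex, which belongs to the other
    -- part or to neither.
    have main : ((∃ u, J s = γ j₁ u) ∨ (∃ u, J s = γ j₃ u) ∨ J s ∈ D.part S) →
        ((∃ u, K t = γ j₂ u) ∨ (∃ u, K t = γ j₄ u) ∨ K t ∈ D.part T) →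
        J s = c := by
      rintro (⟨u, hu⟩ | ⟨u, hu⟩ | hu) (⟨v, hv⟩ | ⟨v, hv⟩ | hv)
      · exact hu.trans (hcommon _ _ n12 u v (by rw [← hu, ← hv, heq]))
      · exact hu.trans (hcommon _ _ n14 u v (by rw [← hu, ← hv, heq]))
      · exact absurd (by rw [← hu, heq]; exact hv) (hpart T _ u fun h => hST hmemS.1 h)
      · exact hu.trans (hcommon _ _ n32 u v (by rw [← hu, ← hv, heq]))
      · exact hu.trans (hcommon _ _ n34 u v (by rw [← hu, ← hv, heq]))
      · exact absurd (by rw [← hu, heq]; exact hv) (hpart T _ u fun h => hST hmemS.2 h)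
      · exact absurd (by rw [← hv, ← heq]; exact hu) (hpart S _ v fun h => hST h hmemT.1)
      · exact absurd (by rw [← hv, ← heq]; exact hu) (hpart S _ v fun h => hST h hmemT.2)
      · exact absurd (heq ▸ hv) (hdis hu)
    have hc := main (hJ s) (hK t)
    have hne : ∀ (i j : ι), θ i ≠ θ j → ∀ u, u ≠ 0 → c ≠ γ i u := by
      intro i j hij u hu h
      exact hcross i j hij u 0 (Or.inl hu) (by rw [← h, (γ j).source])
    have hcp : ∀ A : Set W, ∀ i, p i ∉ A → c ∉ D.part A := by
      intro A i hi h
      exact hpart A i 0 hi (by rwa [(γ i).source])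
    -- One of the two parameters is interior, and there its loop has left `c`.
    rcases hst with hs | ht
    · rcases hJ' s hs with ⟨u, hu, h⟩ | ⟨u, hu, h⟩ | h
      · exact hne _ _ n12 u hu (hc.symm.trans h)
      · exact hne _ _ n32 u hu (hc.symm.trans h)
      · exact hcp S j₂ (fun h => hST h hmemT.1) (hc ▸ h)
    · rw [heq] at hc
      rcases hK' t ht with ⟨u, hu, h⟩ | ⟨u, hu, h⟩ | h
      · exact hne _ _ n12.symm u hu (hc.symm.trans h)
      · exact hne _ _ n14.symm u hu (hc.symm.trans h)
      · exact hcp T j₁ (fun h => hST hmemS.1 h) (hc ▸ h)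
  rcases hmono with hm | hm
  · exact key i₁ i₂ i₃ i₄ S T (hm h12) (hm h23) (hm h34) hST hS hT
  -- For decreasing angles the four indices are read backwards, which exchanges the roles of the two
  -- walks.
  · exact key i₄ i₃ i₂ i₁ T S (hm h34) (hm h23) (hm h12) hST.symm hT.symm hS.symm

end PlaneDrawing

/-- Edges `a i`, `b i` in alternating cyclic order on a face: disjoint walks cannot join
`a i` to `a j` and `b i` to `b j`. -/
theorem PlaneDrawing.not_joinedInside_alternating {W : Type*} {G : SimpleGraph W}
    (D : PlaneDrawing G) {f : Set ℂ} (hf : D.IsFace f) {k : ℕ} {a b : Fin k → W}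
    (hcyc : D.InCyclicOrder f (alternating a b)) {i j : Fin k} (hij : i ≠ j)
    {S T : Set W} (hST : Disjoint S T) (hS : JoinedInside G S (a i) (a j))
    (hT : JoinedInside G T (b i) (b j)) : False := by
  have key : ∀ i j : Fin k, i < j → JoinedInside G S (a i) (a j) →
      JoinedInside G T (b i) (b j) → False := by
    intro i j hij hS hT
    refine D.not_joinedInside_interlaced hf hcyc (i₁ := toLex (i, 0)) (i₂ := toLex (i, 1))
      (i₃ := toLex (j, 0)) (i₄ := toLex (j, 1)) ?_ ?_ ?_ hST (by simpa [alternating] using hS)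
      (by simpa [alternating] using hT)
    · simp [Prod.Lex.lt_iff]
    · simp [Prod.Lex.lt_iff, hij]
    · simp [Prod.Lex.lt_iff]
  rcases lt_or_gt_of_ne hij with h | h
  · exact key i j h hS hT
  · exact key j i h hS.symm hT.symm

/-! ### Perfect matchings as bijections between the colour classes -/

section Matching

variable {W R : Type*} {G : SimpleGraph W} {U V : Set W}

lemma sym2_inj_of_disjoint (hd : Disjoint U V) {u u' : U} {v v' : V}
    (h : s((u : W), (v : W)) = s((u' : W), (v' : W))) : u = u' ∧ v = v' := by
  rw [Set.disjoint_left] at hd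
  rcases Sym2.eq_iff.1 h with ⟨h1, h2⟩ | ⟨h1, h2⟩
  · exact ⟨Subtype.ext h1, Subtype.ext h2⟩
  · exact absurd (h1 ▸ v'.2) (hd u.2)

variable [CommRing R] [Fintype W] [Fintype U] [Fintype V] [DecidableEq U] [DecidableEq V]

open Classical in
/-- The matching sum of a bipartite graph from which a set `X` of vertices of the first colour class
and its image under an injection `g` have been deleted, as a sum over the bijections
between the colour classes that extend `g`. -/
lemma matchingSum_eq_sum_equiv (ω : Sym2 W → R) (hUV : U ∪ V = Set.univ)
    (hG : G.IsBipartiteWith U V) (hcard : Fintype.card U = Fintype.card V) (H : G.Subgraph)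
    (X : Finset U) (g : U → V) (hg : Set.InjOn g X)
    (hverts : ∀ w, w ∈ H.verts ↔ ∀ u ∈ X, (u : W) ≠ w ∧ (g u : W) ≠ w) :
    matchingSum ω H =
      ∑ P : U ≃ V with (∀ u ∈ X, P u = g u) ∧ ∀ u ∉ X, H.Adj (u : W) (P u : W),
        ∏ u ∈ Xᶜ, ω s((u : W), (P u : W)) := by
  have hd := Set.disjoint_left.1 hG.disjoint
  have hUverts : ∀ u : U, (u : W) ∈ H.verts ↔ u ∉ X := by
    intro u
    rw [hverts]
    constructor
    · exact fun h hu => (h u hu).1 rfl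
    · refine fun h x hx => ⟨fun h' => h (by rwa [← Subtype.ext h']), fun h' => ?_⟩
      exact hd u.2 (h' ▸ (g x).2)
  have hVverts : ∀ v : V, (v : W) ∈ H.verts ↔ ∀ x ∈ X, g x ≠ v := by
    intro v
    rw [hverts]
    constructor
    · exact fun h x hx hv => (h x hx).2 (congrArg _ hv)
    · exact fun h x hx => ⟨fun h' => hd x.2 (h' ▸ v.2), fun h' => h x hx (Subtype.ext h')⟩
  have hcases : ∀ w : W, (∃ u : U, (u : W) = w) ∨ ∃ v : V, (v : W) = w := by
    intro w
    rcases (hUV ▸ Set.mem_univ w : w ∈ U ∪ V) with h | h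
    exacts [Or.inl ⟨⟨w, h⟩, rfl⟩, Or.inr ⟨⟨w, h⟩, rfl⟩]
  have hedge : ∀ e ∈ H.edgeSet, ∃ (u : U) (v : V), e = s((u : W), (v : W)) ∧ H.Adj (u : W) v := by
    intro e
    induction e with
    | _ x y =>
      intro he
      rcases hG.mem_of_adj (H.adj_sub he) with ⟨hx, hy⟩ | ⟨hx, hy⟩
      · exact ⟨⟨x, hx⟩, ⟨y, hy⟩, rfl, he⟩
      · exact ⟨⟨y, hy⟩, ⟨x, hx⟩, Sym2.eq_swap, H.adj_symm he⟩
  have hmemU : ∀ (u u' : U) (v : V), (u : W) ∈ s((u' : W), (v : W)) ↔ u = u' := by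
    intro u u' v
    rw [Sym2.mem_iff]
    exact ⟨fun h => h.elim (fun h => Subtype.ext h) fun h => absurd (h ▸ v.2) (hd u.2),
      fun h => Or.inl (congrArg _ h)⟩
  have hmemV : ∀ (v v' : V) (u : U), (v : W) ∈ s((u : W), (v' : W)) ↔ v = v' := by
    intro v v' u
    rw [Sym2.mem_iff]
    exact ⟨fun h => h.elim (fun h => absurd v.2 (hd (h ▸ u.2))) fun h => Subtype.ext h,
      fun h => Or.inr (congrArg _ h)⟩
  symm
  unfold matchingSum
  refine Finset.sum_bij (fun P _ => Xᶜ.image fun u : U => s((u : W), (P u : W))) ?_ ?_ ?_ ?_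
  · intro P hP
    simp only [Finset.mem_filter, Finset.mem_univ, true_and] at hP ⊢
    refine ⟨?_, ?_⟩
    · intro e he
      obtain ⟨u, hu, rfl⟩ := Finset.mem_image.1 he
      exact hP.2 u (Finset.mem_compl.1 hu)
    · intro w hw
      rcases hcases w with ⟨u, rfl⟩ | ⟨v, rfl⟩
      · have hu := (hUverts u).1 hw
        refine ⟨s((u : W), (P u : W)), ⟨Finset.mem_image_of_mem _ (Finset.mem_compl.2 hu),
          Sym2.mem_mk_left _ _⟩, ?_⟩
        rintro e ⟨he, hue⟩
        obtain ⟨u', hu', rfl⟩ := Finset.mem_image.1 he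
        rw [(hmemU _ _ _).1 hue]
      · have hv := (hVverts v).1 hw
        have hu : P.symm v ∉ X := fun h => hv _ h (by rw [← hP.1 _ h, P.apply_symm_apply])
        refine ⟨s((P.symm v : W), (P (P.symm v) : W)),
          ⟨Finset.mem_image_of_mem (fun u : U => s((u : W), (P u : W))) (Finset.mem_compl.2 hu), by simp⟩, ?_⟩
        rintro e ⟨he, hve⟩
        obtain ⟨u', hu', rfl⟩ := Finset.mem_image.1 he
        rw [(hmemV _ _ _).1 hve, P.symm_apply_apply]
  · intro P hP Q hQ hPQ
    simp only [Finset.mem_filter, Finset.mem_univ, true_and] at hP hQ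
    ext1 u
    by_cases hu : u ∈ X
    · rw [hP.1 u hu, hQ.1 u hu]
    · have hm : s((u : W), (P u : W)) ∈ Xᶜ.image fun u : U => s((u : W), (Q u : W)) := by
        rw [← hPQ]
        exact Finset.mem_image_of_mem (fun u : U => s((u : W), (P u : W))) (Finset.mem_compl.2 hu)
      obtain ⟨u', -, h⟩ := Finset.mem_image.1 hm
      obtain ⟨rfl, h⟩ := sym2_inj_of_disjoint hG.disjoint h
      exact h.symm
  · intro M hM
    simp only [Finset.mem_filter, Finset.mem_univ, true_and] at hM
    obtain ⟨hM1, hM2⟩ := hM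
    -- The bijection behind the matching `M`: prescribed by `g` on deleted vertices, the partner in
    -- `M` elsewhere.
    have hex : ∀ u : U, ∃ v : V, (u ∈ X → v = g u) ∧ (u ∉ X → s((u : W), (v : W)) ∈ M ∧
        H.Adj (u : W) v) := by
      intro u
      by_cases hu : u ∈ X
      · exact ⟨g u, by simp [hu]⟩
      · obtain ⟨e, ⟨heM, hue⟩, -⟩ := hM2 u ((hUverts u).2 hu)
        obtain ⟨u', v, rfl, hadj⟩ := hedge e (hM1 e heM)
        obtain rfl := (hmemU _ _ _).1 hue
        exact ⟨v, by simp [hu, heM, hadj]⟩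
    choose F hFX hF using hex
    have hFV : ∀ u ∉ X, ∀ x ∈ X, F u ≠ F x := by
      intro u hu x hx h
      refine (hVverts (F u)).1 (H.edge_vert (hF u hu).2.symm) x hx ?_
      rw [h, hFX x hx]
    have hinj : Function.Injective F := by
      intro u u' h
      by_cases hu : u ∈ X <;> by_cases hu' : u' ∈ X
      · exact hg hu hu' (by rw [← hFX u hu, ← hFX u' hu', h])
      · exact absurd h.symm (hFV u' hu' u hu)
      · exact absurd h (hFV u hu u' hu')
      · obtain ⟨e, -, he⟩ := hM2 (F u) (H.edge_vert (hF u hu).2.symm)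
        have h1 := he _ ⟨(hF u hu).1, by simp⟩
        have h2 := he _ ⟨(hF u' hu').1, by simp [h]⟩
        exact (sym2_inj_of_disjoint hG.disjoint (h1.trans h2.symm)).1
    have hbij : Function.Bijective F :=
      (Fintype.bijective_iff_injective_and_card F).2 ⟨hinj, hcard⟩
    refine ⟨Equiv.ofBijective F hbij, ?_, ?_⟩
    · simp only [Finset.mem_filter, Finset.mem_univ, true_and, Equiv.ofBijective_apply]
      exact ⟨fun u hu => hFX u hu, fun u hu => (hF u hu).2⟩
    · ext e
      simp only [Finset.mem_image, Finset.mem_compl, Equiv.ofBijective_apply]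
      constructor
      · rintro ⟨u, hu, rfl⟩
        exact (hF u hu).1
      · intro he
        obtain ⟨u, v, rfl, hadj⟩ := hedge e (hM1 e he)
        have hu := H.edge_vert hadj
        refine ⟨u, (hUverts u).1 hu, ?_⟩
        obtain ⟨e', -, he'⟩ := hM2 u hu
        rw [he' _ ⟨(hF u ((hUverts u).1 hu)).1, by simp⟩, he' _ ⟨he, by simp⟩]
  · intro P hP
    rw [Finset.prod_image]
    intro u _ u' _ h
    exact (sym2_inj_of_disjoint hG.disjoint h).1

end Matching

/-! ### Cycles of a permutation times a transposition -/

namespace Equiv.Perm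

variable {A : Type*} {ρ : Equiv.Perm A} {x y z : A}

lemma sameCycle_iff_exists_iterate [Finite A] : ρ.SameCycle x z ↔ ∃ l : ℕ, ρ^[l] x = z := by
  constructor
  · intro h
    obtain ⟨l, -, hl⟩ := h.exists_pow_eq'
    exact ⟨l, by rw [iterate_eq_pow, hl]⟩
  · rintro ⟨l, rfl⟩
    rw [iterate_eq_pow]
    exact ⟨l, by simp⟩

lemma minimalPeriod_pos [Finite A] (ρ : Equiv.Perm A) (x : A) :
    0 < Function.minimalPeriod ρ x :=
  Function.minimalPeriod_pos_of_mem_periodicPts (ρ.injective.mem_periodicPts x)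

lemma sameCycle_iff_exists_lt_of_iterate_eq [Finite A] {m : ℕ} (hm : 0 < m) (h : ρ^[m] x = x) :
    ρ.SameCycle x z ↔ ∃ l < m, ρ^[l] x = z := by
  rw [sameCycle_iff_exists_iterate]
  constructor
  · rintro ⟨l, rfl⟩
    refine ⟨l % m, Nat.mod_lt _ hm, ?_⟩
    exact Function.IsPeriodicPt.iterate_mod_apply (f := ρ) h l
  · rintro ⟨l, -, h⟩
    exact ⟨l, h⟩

variable [DecidableEq A]

/-- The transposition acts after `ρ`, so it is not felt until `ρ` reaches `x` or `y`. -/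
lemma swap_mul_iterate {m : ℕ} (h : ∀ l, 0 < l → l < m → ρ^[l] x ≠ x ∧ ρ^[l] x ≠ y) :
    ∀ l < m, (Equiv.swap x y * ρ)^[l] x = ρ^[l] x := by
  intro l hl
  induction l with
  | zero => rfl
  | succ l ih =>
    rw [Function.iterate_succ_apply', ih (by omega), Function.iterate_succ_apply',
      Equiv.Perm.mul_apply]
    have := h (l + 1) (by omega) hl
    rw [Function.iterate_succ_apply'] at this
    exact Equiv.swap_apply_of_ne_of_ne this.1 this.2

lemma swap_mul_iterate_self {m : ℕ} (hm : 0 < m)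
    (h : ∀ l, 0 < l → l < m → ρ^[l] x ≠ x ∧ ρ^[l] x ≠ y) :
    (Equiv.swap x y * ρ)^[m] x = Equiv.swap x y (ρ^[m] x) := by
  obtain ⟨m, rfl⟩ := Nat.exists_eq_succ_of_ne_zero hm.ne'
  rw [Function.iterate_succ_apply', swap_mul_iterate h m (Nat.lt_succ_self m), Equiv.Perm.mul_apply,
    ← Function.iterate_succ_apply' ρ]

/-- Multiplying with a transposition of two points of one cycle splits the cycle. -/
lemma sameCycle_swap_mul_iff [Finite A] {m : ℕ} (hxy : x ≠ y) (hm : ρ^[m] x = y)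
    (hmin : ∀ l < m, ρ^[l] x ≠ y) :
    (Equiv.swap x y * ρ).SameCycle x z ↔ ∃ l < m, ρ^[l] x = z := by
  have hm0 : 0 < m := by
    rcases Nat.eq_zero_or_pos m with rfl | h
    · exact absurd hm hxy
    · exact h
  have h : ∀ l, 0 < l → l < m → ρ^[l] x ≠ x ∧ ρ^[l] x ≠ y := by
    -- A return to `x` after `l < m` steps would make `y` appear already at step `m - l`.
    refine fun l h0 hl => ⟨fun hx => hmin (m - l) (by omega) ?_, hmin l hl⟩
    rw [← hm]
    conv_rhs => rw [← Nat.sub_add_cancel hl.le, Function.iterate_add_apply, hx]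
  rw [sameCycle_iff_exists_lt_of_iterate_eq hm0
    (by rw [swap_mul_iterate_self hm0 h, hm, Equiv.swap_apply_right])]
  exact exists_congr fun l => and_congr_right fun hl => by rw [swap_mul_iterate h l hl]

lemma exists_first_iterate [Finite A] (h : ρ.SameCycle x y) :
    ∃ m, ρ^[m] x = y ∧ ∀ l < m, ρ^[l] x ≠ y := by
  classical
  have h' := sameCycle_iff_exists_iterate.1 h
  exact ⟨Nat.find h', Nat.find_spec h', fun l hl => Nat.find_min h' hl⟩

/-- Multiplying with a transposition of two points of different cycles merges the cycles. -/
lemma SameCycle.swap_mul_of_not_sameCycle [Finite A] (h : ¬ ρ.SameCycle x y) (hz : ρ.SameCycle x z) :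
    (Equiv.swap x y * ρ).SameCycle x z := by
  have hy : ∀ l, ρ^[l] x ≠ y := fun l hl => h (sameCycle_iff_exists_iterate.2 ⟨l, hl⟩)
  have hN := minimalPeriod_pos ρ x
  obtain ⟨l, hl, rfl⟩ := (sameCycle_iff_exists_lt_of_iterate_eq hN
    Function.iterate_minimalPeriod).1 hz
  refine sameCycle_iff_exists_iterate.2 ⟨l, swap_mul_iterate (fun i h0 hi => ⟨?_, hy i⟩) l hl⟩
  exact fun hx => absurd (Function.IsPeriodicPt.minimalPeriod_le (f := ρ) h0 hx) (by omega)

/-- After one full period `ρ` returns to `x`, which the transposition redirects to `y`. -/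
lemma sameCycle_swap_mul_of_not_sameCycle [Finite A] (h : ¬ ρ.SameCycle x y) :
    (Equiv.swap x y * ρ).SameCycle x y := by
  have hy : ∀ l, ρ^[l] x ≠ y := fun l hl => h (sameCycle_iff_exists_iterate.2 ⟨l, hl⟩)
  have hN := minimalPeriod_pos ρ x
  refine sameCycle_iff_exists_iterate.2 ⟨_, (swap_mul_iterate_self hN
    (fun i h0 hi => ⟨?_, hy i⟩)).trans ?_⟩
  · exact fun hx => absurd (Function.IsPeriodicPt.minimalPeriod_le (f := ρ) h0 hx) (by omega)
  · rw [Function.iterate_minimalPeriod, Equiv.swap_apply_left]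

/-- Among the points of a set on the cycle of `x` there is a unique one that is met first. -/
lemma existsUnique_first_on_cycle [Finite A] {T : Set A} (hx : x ∉ T) (hT : ∃ y ∈ T, ρ.SameCycle x y) :
    ∃! y, y ∈ T ∧ ∀ z ∈ T, ¬ (Equiv.swap x y * ρ).SameCycle x z := by
  classical
  have hex : ∃ m, ρ^[m] x ∈ T := by
    obtain ⟨y, hy, h⟩ := hT
    obtain ⟨m, rfl⟩ := sameCycle_iff_exists_iterate.1 h
    exact ⟨m, hy⟩
  have hspec := Nat.find_spec hex
  have hmin : ∀ l < Nat.find hex, ρ^[l] x ∉ T := fun l hl => Nat.find_min hex hl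
  set m := Nat.find hex
  have hne : ∀ {y}, y ∈ T → x ≠ y := fun hy h => hx (h ▸ hy)
  refine ⟨ρ^[m] x, ⟨hspec, ?_⟩, ?_⟩
  · intro z hz
    rw [sameCycle_swap_mul_iff (hne hspec) rfl fun l hl h => hmin l hl (h ▸ hspec)]
    rintro ⟨l, hl, rfl⟩
    exact hmin l hl hz
  · rintro y ⟨hy, hyT⟩
    have hsc : ρ.SameCycle x y := by
      by_contra h
      exact hyT y hy (sameCycle_swap_mul_of_not_sameCycle h)
    obtain ⟨n, hn, hnmin⟩ := exists_first_iterate hsc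
    -- The split-off cycle consists of the iterates before `y`; were `y` later than the first point
    -- of `T`, it would contain that point.
    have hmn : n ≤ m := by
      by_contra! h
      exact hyT _ hspec ((sameCycle_swap_mul_iff (hne hy) hn hnmin).2 ⟨m, h, rfl⟩)
    have hnm : ¬ n < m := fun h => hmin n h (hn ▸ hy)
    rw [← hn, show n = m by omega]

end Equiv.Perm

/-! ### Exchange of two bijections along a cycle -/

section Exchange

variable {A B : Type*}

/-- The permutation `P⁻¹ Q` of a pair `(P, Q)` of bijections. -/
def ratio (p : (A ≃ B) × (A ≃ B)) : Equiv.Perm A := p.2.trans p.1.symm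

open Classical in
/-- Exchange the values of two bijections on the cycle of `x` in their superposition. -/
noncomputable def exchange (x : A) (p : (A ≃ B) × (A ≃ B)) : (A ≃ B) × (A ≃ B) :=
  (((ratio p).cycleOf x).trans p.1, ((ratio p).cycleOf x).symm.trans p.2)

variable {x u : A} {p : (A ≃ B) × (A ≃ B)}

lemma fst_ratio_apply (p : (A ≃ B) × (A ≃ B)) (u : A) : p.1 (ratio p u) = p.2 u := by
  simp [ratio]

lemma exchange_of_sameCycle (h : (ratio p).SameCycle x u) :
    (exchange x p).1 u = p.2 u ∧ (exchange x p).2 u = p.1 u := by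
  classical
  constructor
  · simp only [exchange, Equiv.trans_apply]
    rw [h.cycleOf_apply, fst_ratio_apply]
  · simp only [exchange, Equiv.trans_apply]
    have : ((ratio p).cycleOf x).symm u = (ratio p).symm u := by
      rw [Equiv.symm_apply_eq, Equiv.Perm.SameCycle.cycleOf_apply]
      · simp
      · exact Equiv.Perm.sameCycle_symm_apply_right.2 h
    rw [this]
    simp [ratio]

lemma exchange_of_not_sameCycle (h : ¬ (ratio p).SameCycle x u) :
    (exchange x p).1 u = p.1 u ∧ (exchange x p).2 u = p.2 u := by
  classical
  have h1 := Equiv.Perm.cycleOf_apply_of_not_sameCycle h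
  constructor
  · simp only [exchange, Equiv.trans_apply]
    rw [h1]
  · simp only [exchange, Equiv.trans_apply]
    rw [(Equiv.symm_apply_eq _).2 h1.symm]

lemma exchange_cases (x : A) (p : (A ≃ B) × (A ≃ B)) (u : A) :
    ((exchange x p).1 u = p.2 u ∧ (exchange x p).2 u = p.1 u) ∨
      ((exchange x p).1 u = p.1 u ∧ (exchange x p).2 u = p.2 u) := by
  by_cases h : (ratio p).SameCycle x u
  exacts [Or.inl (exchange_of_sameCycle h), Or.inr (exchange_of_not_sameCycle h)]

/-- On the cycle of `x` the exchange inverts the ratio, so the same cycle is traversed backwards. -/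
lemma sameCycle_ratio_exchange [Finite A] : (ratio (exchange x p)).SameCycle x u ↔ (ratio p).SameCycle x u := by
  have key : ∀ l : ℕ, (ratio (exchange x p))^[l] x = (⇑(ratio p)⁻¹)^[l] x := by
    intro l
    induction l with
    | zero => rfl
    | succ l ih =>
      rw [Function.iterate_succ_apply', Function.iterate_succ_apply', ih]
      set v := (⇑(ratio p)⁻¹)^[l] x with hv
      have hvc : (ratio p).SameCycle x v :=
        Equiv.Perm.sameCycle_inv.1 (Equiv.Perm.sameCycle_iff_exists_iterate.2 ⟨l, hv.symm⟩)
      have hvc' : (ratio p).SameCycle x ((ratio p)⁻¹ v) :=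
        Equiv.Perm.sameCycle_symm_apply_right.2 hvc
      apply (exchange x p).1.injective
      rw [fst_ratio_apply, (exchange_of_sameCycle hvc).2, (exchange_of_sameCycle hvc').1,
        ← fst_ratio_apply]
      simp
  rw [← Equiv.Perm.sameCycle_inv (f := ratio p), Equiv.Perm.sameCycle_iff_exists_iterate,
    Equiv.Perm.sameCycle_iff_exists_iterate]
  simp only [key]

lemma exchange_involutive [Finite A] (x : A) : Function.Involutive (exchange x : (A ≃ B) × (A ≃ B) → _) := by
  intro p
  have h : ∀ u, (exchange x (exchange x p)).1 u = p.1 u ∧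
      (exchange x (exchange x p)).2 u = p.2 u := by
    intro u
    by_cases h : (ratio p).SameCycle x u
    · have h1 := exchange_of_sameCycle (sameCycle_ratio_exchange.2 h)
      have h2 := exchange_of_sameCycle h
      exact ⟨h1.1.trans h2.2, h1.2.trans h2.1⟩
    · have h1 := exchange_of_not_sameCycle (mt sameCycle_ratio_exchange.1 h)
      have h2 := exchange_of_not_sameCycle h
      exact ⟨h1.1.trans h2.1, h1.2.trans h2.2⟩
  exact Prod.ext (Equiv.ext fun u => (h u).1) (Equiv.ext fun u => (h u).2)

variable [DecidableEq A]

/-- Exchange the values of the first bijection at `x` and `y`. -/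
def swapFst (x y : A) (p : (A ≃ B) × (A ≃ B)) : (A ≃ B) × (A ≃ B) :=
  ((Equiv.swap x y).trans p.1, p.2)

lemma swapFst_involutive (x y : A) :
    Function.Involutive (swapFst x y : (A ≃ B) × (A ≃ B) → _) := by
  intro p
  refine Prod.ext (Equiv.ext fun u => ?_) rfl
  simp [swapFst]

lemma ratio_swapFst (x y : A) (p : (A ≃ B) × (A ≃ B)) :
    ratio (swapFst x y p) = Equiv.swap x y * ratio p := by
  ext u
  simp [ratio, swapFst]

end Exchange

/-! ### The condensation identity for pairs of bijections -/

section Counting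

variable {A B ι R : Type*} [CommRing R] [Fintype A]
  {adj : A → B → Prop} {a : ι → A} {b : ι → B}

/-- The product of the weights of all pairs in the graphs of two bijections. -/
def pairWeight (c : A → B → R) (p : (A ≃ B) × (A ≃ B)) : R :=
  ∏ u, c u (p.1 u) * c u (p.2 u)

lemma pairWeight_exchange (c : A → B → R) (x : A) (p : (A ≃ B) × (A ≃ B)) :
    pairWeight c (exchange x p) = pairWeight c p := by
  refine Finset.prod_congr rfl fun u _ => ?_
  rcases exchange_cases x p u with ⟨h1, h2⟩ | ⟨h1, h2⟩ <;> rw [h1, h2]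
  exact mul_comm _ _

/-- Both bijections of the pair take values in the relation `adj`, the first one matches
`a j` and `b j`, and the second one does not match `a t` and `b t` for any `t`. -/
def IsFirstOnly (adj : A → B → Prop) (a : ι → A) (b : ι → B) (j : ι)
    (p : (A ≃ B) × (A ≃ B)) : Prop :=
  (∀ u, adj u (p.1 u) ∧ adj u (p.2 u)) ∧ p.1 (a j) = b j ∧ ∀ t, p.2 (a t) ≠ b t

/-- No cycle of the superposition of two bijections contains pairs `a i`, `b i` of different
bijections. -/
def NoOpposite (adj : A → B → Prop) (a : ι → A) (b : ι → B) : Prop :=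
  ∀ i j, i ≠ j → ∀ p : (A ≃ B) × (A ≃ B), (∀ u, adj u (p.1 u) ∧ adj u (p.2 u)) →
    p.1 (a j) = b j → p.2 (a i) = b i → ¬ (ratio p).SameCycle (a j) (a i)

/-- The virtual pairs `a i`, `b j` and `a j`, `b i` of two bijections are never in the same cycle of
their superposition. -/
def NoVirtual (adj : A → B → Prop) (a : ι → A) (b : ι → B) : Prop :=
  ∀ i j, i ≠ j → ∀ p : (A ≃ B) × (A ≃ B), (∀ u, u ≠ a i → adj u (p.1 u)) →
    (∀ u, u ≠ a j → adj u (p.2 u)) → p.1 (a i) = b j → p.2 (a j) = b i →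
    ¬ (ratio p).SameCycle (a j) (a i)

variable [DecidableEq A] [Fintype B] [DecidableEq B]

-- Exchange along the cycle of `a j` moves its partner `b j` into the first bijection. `NoOpposite`
-- ensures that no other marked pair moves into the second one.
open Classical in
lemma sum_pairWeight_swap_single [Fintype ι] (c : A → B → R)
    (hopp : NoOpposite adj a b) (j : ι) :
    ∑ p : (A ≃ B) × (A ≃ B) with (∀ u, adj u (p.1 u) ∧ adj u (p.2 u)) ∧
        p.1 (a j) ≠ b j ∧ p.2 (a j) = b j ∧ ∀ t ≠ j, p.2 (a t) ≠ b t, pairWeight c p =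
    ∑ p : (A ≃ B) × (A ≃ B) with IsFirstOnly adj a b j p ∧
        ∀ t ≠ j, (ratio p).SameCycle (a j) (a t) → p.1 (a t) ≠ b t, pairWeight c p := by
  have hadj : ∀ p : (A ≃ B) × (A ≃ B), (∀ u, adj u (p.1 u) ∧ adj u (p.2 u)) →
      ∀ u, adj u ((exchange (a j) p).1 u) ∧ adj u ((exchange (a j) p).2 u) := by
    intro p hp u
    rcases exchange_cases (a j) p u with ⟨h1, h2⟩ | ⟨h1, h2⟩ <;> rw [h1, h2]
    exacts [(hp u).symm, hp u]
  refine Finset.sum_nbij' (exchange (a j)) (exchange (a j)) ?_ ?_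
    (fun p _ => exchange_involutive _ p) (fun p _ => exchange_involutive _ p)
    (fun p _ => (pairWeight_exchange c _ p).symm)
  · intro p hp
    simp only [Finset.mem_filter, Finset.mem_univ, true_and] at hp ⊢
    obtain ⟨h1, h2, h3, h4⟩ := hp
    have hjj := exchange_of_sameCycle (Equiv.Perm.SameCycle.refl (ratio p) (a j))
    have h1' := hadj p h1
    refine ⟨⟨h1', hjj.1.trans h3, ?_⟩, ?_⟩
    · intro t ht
      by_cases htj : t = j
      · subst htj
        exact h2 (hjj.2.symm.trans ht)
      · by_cases hs : (ratio p).SameCycle (a j) (a t)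
        · exact hopp t j htj _ h1' (hjj.1.trans h3) ht (sameCycle_ratio_exchange.2 hs)
        · exact h4 t htj ((exchange_of_not_sameCycle hs).2.symm.trans ht)
    · intro t htj hs ht
      exact h4 t htj ((exchange_of_sameCycle (sameCycle_ratio_exchange.1 hs)).1.symm.trans ht)
  · intro p hp
    simp only [Finset.mem_filter, Finset.mem_univ, true_and] at hp ⊢
    obtain ⟨⟨h1, h2, h3⟩, h4⟩ := hp
    have hjj := exchange_of_sameCycle (Equiv.Perm.SameCycle.refl (ratio p) (a j))
    refine ⟨hadj p h1, ?_, hjj.2.trans h2, ?_⟩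
    · rw [hjj.1]; exact h3 j
    · intro t htj
      by_cases hs : (ratio p).SameCycle (a j) (a t)
      · rw [(exchange_of_sameCycle hs).2]; exact h4 t htj hs
      · rw [(exchange_of_not_sameCycle hs).2]; exact h3 t

-- A swap at `a j`, `a i` trades the marked pairs `i`, `j` of the first bijection for the virtual
-- ones, and the exchange moves `a j`, `b i` to the second. The condition on the split cycle keeps
-- marked pairs out of the second bijection. For the inverse, `NoVirtual` separates the two virtual
-- pairs, so that the swap can restore the marked ones.
open Classical in
lemma sum_pairWeight_swap_virtual [Fintype ι] (c : A → B → R) (ha : a.Injective) (hb : b.Injective)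
    (hab : ∀ t, adj (a t) (b t))
    (hopp : NoOpposite adj a b) (hvirt : NoVirtual adj a b) {i j : ι} (hij : i ≠ j) :
    ∑ p : (A ≃ B) × (A ≃ B) with IsFirstOnly adj a b j p ∧ p.1 (a i) = b i ∧
        ∀ t ≠ j, (Equiv.swap (a j) (a i) * ratio p).SameCycle (a j) (a t) → p.1 (a t) ≠ b t,
      pairWeight c p =
    ∑ p : (A ≃ B) × (A ≃ B) with (p.1 (a i) = b j ∧ ∀ u ≠ a i, adj u (p.1 u)) ∧
        (p.2 (a j) = b i ∧ (∀ u ≠ a j, adj u (p.2 u)) ∧ ∀ t, p.2 (a t) ≠ b t),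
      c (a i) (b i) * c (a j) (b j) *
        ((∏ u ∈ {a i}ᶜ, c u (p.1 u)) * ∏ u ∈ {a j}ᶜ, c u (p.2 u)) := by
  have haij : a i ≠ a j := fun h => hij (ha h)
  have hbij : b i ≠ b j := fun h => hij (hb h)
  refine Finset.sum_nbij' (fun p => exchange (a j) (swapFst (a j) (a i) p))
    (fun p => swapFst (a j) (a i) (exchange (a j) p)) ?_ ?_
    (fun p _ => by simp only [exchange_involutive _ _, swapFst_involutive _ _ _])
    (fun p _ => by simp only [exchange_involutive _ _, swapFst_involutive _ _ _]) ?_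
  · intro p hp
    simp only [Finset.mem_filter, Finset.mem_univ, true_and] at hp ⊢
    obtain ⟨⟨h1, h2, h3⟩, h4, h5⟩ := hp
    rw [← ratio_swapFst] at h5
    set q := swapFst (a j) (a i) p with hq
    have hqj : q.1 (a j) = b i := by simp [hq, swapFst, h4]
    have hqi : q.1 (a i) = b j := by simp [hq, swapFst, h2]
    have hqu : ∀ u, u ≠ a j → u ≠ a i → q.1 u = p.1 u := fun u hu hu' => by
      simp [hq, swapFst, Equiv.swap_apply_of_ne_of_ne hu hu']
    have hi : ¬ (ratio q).SameCycle (a j) (a i) := fun h => h5 i hij h h4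
    have hjj := exchange_of_sameCycle (Equiv.Perm.SameCycle.refl (ratio q) (a j))
    refine ⟨⟨(exchange_of_not_sameCycle hi).1.trans hqi, ?_⟩, hjj.2.trans hqj, ?_, ?_⟩
    · intro u hu
      by_cases hs : (ratio q).SameCycle (a j) u
      · rw [(exchange_of_sameCycle hs).1]; exact (h1 u).2
      · have huj : u ≠ a j := by rintro rfl; exact hs (Equiv.Perm.SameCycle.refl _ _)
        rw [(exchange_of_not_sameCycle hs).1, hqu u huj hu]; exact (h1 u).1
    · intro u hu
      by_cases hs : (ratio q).SameCycle (a j) u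
      · have hui : u ≠ a i := by rintro rfl; exact hi hs
        rw [(exchange_of_sameCycle hs).2, hqu u hu hui]; exact (h1 u).1
      · rw [(exchange_of_not_sameCycle hs).2]; exact (h1 u).2
    · intro t
      by_cases htj : t = j
      · subst htj
        rw [hjj.2, hqj]; exact hbij
      · by_cases hs : (ratio q).SameCycle (a j) (a t)
        · have hti : t ≠ i := by rintro rfl; exact hi hs
          rw [(exchange_of_sameCycle hs).2, hqu _ (ha.ne htj) (ha.ne hti)]
          exact h5 t htj hs
        · rw [(exchange_of_not_sameCycle hs).2]; exact h3 t
  · intro p hp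
    simp only [Finset.mem_filter, Finset.mem_univ, true_and] at hp ⊢
    obtain ⟨⟨h1, h2⟩, h3, h4, h5⟩ := hp
    have hi := hvirt i j hij p h2 h4 h1 h3
    have hjj := exchange_of_sameCycle (Equiv.Perm.SameCycle.refl (ratio p) (a j))
    have hii := exchange_of_not_sameCycle hi
    have hratio : ratio (exchange (a j) p) = Equiv.swap (a j) (a i) *
        ratio (swapFst (a j) (a i) (exchange (a j) p)) := by
      rw [← ratio_swapFst, swapFst_involutive]
    set q := swapFst (a j) (a i) (exchange (a j) p) with hq
    rw [← hratio]
    have hqj : q.1 (a j) = b j := by simp [hq, swapFst, hii, h1]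
    have hqi : q.1 (a i) = b i := by simp [hq, swapFst, hjj, h3]
    have hqu : ∀ u, u ≠ a j → u ≠ a i → q.1 u = (exchange (a j) p).1 u := fun u hu hu' => by
      simp [hq, swapFst, Equiv.swap_apply_of_ne_of_ne hu hu']
    have hq2 : ∀ u, q.2 u = (exchange (a j) p).2 u := fun u => rfl
    have hadj : ∀ u, adj u (q.1 u) ∧ adj u (q.2 u) := by
      intro u
      constructor
      · by_cases huj : u = a j
        · rw [huj, hqj]; exact hab j
        by_cases hui : u = a i
        · rw [hui, hqi]; exact hab i
        rw [hqu u huj hui]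
        rcases exchange_cases (a j) p u with h | h <;> rw [h.1]
        exacts [h4 u huj, h2 u hui]
      · rw [hq2]
        by_cases hs : (ratio p).SameCycle (a j) u
        · have hui : u ≠ a i := by rintro rfl; exact hi hs
          rw [(exchange_of_sameCycle hs).2]; exact h2 u hui
        · have huj : u ≠ a j := by rintro rfl; exact hs (Equiv.Perm.SameCycle.refl _ _)
          rw [(exchange_of_not_sameCycle hs).2]; exact h4 u huj
    refine ⟨⟨hadj, hqj, ?_⟩, hqi, ?_⟩
    · intro t ht
      by_cases hs : (ratio p).SameCycle (a j) (a t)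
      · by_cases htj : t = j
        · subst htj
          rw [hq2, hjj.2, ← h1] at ht
          exact haij (p.1.injective ht).symm
        · refine hopp t j htj q hadj hqj ht ?_
          -- Swapping back merges the cycles of `a j` and `a i`, so the pairs `j` and `t` would lie
          -- opposite on one cycle of `q`.
          have hmerge := Equiv.Perm.SameCycle.swap_mul_of_not_sameCycle
            (mt sameCycle_ratio_exchange.1 hi) (sameCycle_ratio_exchange.2 hs)
          rwa [← ratio_swapFst] at hmerge
      · rw [hq2, (exchange_of_not_sameCycle hs).2] at ht
        exact h5 t ht
    · intro t htj hs
      rw [sameCycle_ratio_exchange] at hs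
      have hti : t ≠ i := by rintro rfl; exact hi hs
      rw [hqu _ (ha.ne htj) (ha.ne hti), (exchange_of_sameCycle hs).1]
      exact h5 t
  · intro p hp
    simp only [Finset.mem_filter, Finset.mem_univ, true_and] at hp
    obtain ⟨⟨h1, h2, h3⟩, h4, h5⟩ := hp
    rw [← ratio_swapFst] at h5
    set q := swapFst (a j) (a i) p with hq
    have hqu : ∀ u, u ≠ a j → u ≠ a i → q.1 u = p.1 u := fun u hu hu' => by
      simp [hq, swapFst, Equiv.swap_apply_of_ne_of_ne hu hu']
    have hi : ¬ (ratio q).SameCycle (a j) (a i) := fun h => h5 i hij h h4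
    have hjj := exchange_of_sameCycle (Equiv.Perm.SameCycle.refl (ratio q) (a j))
    have hii := exchange_of_not_sameCycle hi
    set r := exchange (a j) q with hr
    have hsplit : ∀ F : A → R, ∏ u, F u = F (a i) * F (a j) * ∏ u ∈ {a i, a j}ᶜ, F u := by
      intro F
      rw [← Finset.prod_mul_prod_compl {a i, a j}, Finset.prod_pair haij]
    have hsplit1 : ∀ x y : A, x ≠ y → ∀ F : A → R,
        ∏ u ∈ ({x} : Finset A)ᶜ, F u = F y * ∏ u ∈ {x, y}ᶜ, F u := by
      intro x y hxy F
      have : ({x} : Finset A)ᶜ = insert y ({x, y} : Finset A)ᶜ := by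
        ext u
        by_cases h : u = y <;> simp [h, hxy.symm]
      rw [this, Finset.prod_insert (by simp)]
    -- At `a i` and `a j` the weights of `p.1` become the prefactor, while those of `p.2` are shared
    -- out, one to each product.
    rw [hsplit1 _ _ haij, hsplit1 _ _ haij.symm, Finset.pair_comm (a j) (a i), pairWeight, hsplit,
      h2, h4]
    have hrest : ∏ u ∈ {a i, a j}ᶜ, c u (p.1 u) * c u (p.2 u) =
        (∏ u ∈ {a i, a j}ᶜ, c u (r.1 u)) * ∏ u ∈ {a i, a j}ᶜ, c u (r.2 u) := by
      rw [← Finset.prod_mul_distrib]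
      refine Finset.prod_congr rfl fun u hu => ?_
      simp only [Finset.mem_compl, Finset.mem_insert, Finset.mem_singleton, not_or] at hu
      rcases exchange_cases (a j) q u with ⟨e1, e2⟩ | ⟨e1, e2⟩ <;>
        rw [e1, e2, hqu u hu.2 hu.1]
      exacts [mul_comm _ _, rfl]
    rw [hrest, hjj.1, hii.2]
    change c (a i) (b i) * c (a i) (p.2 (a i)) * (c (a j) (b j) * c (a j) (p.2 (a j))) * _ =
      c (a i) (b i) * c (a j) (b j) * (c (a j) (p.2 (a j)) * _ * (c (a i) (p.2 (a i)) * _))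
    ring

-- If the cycle of `a j` carries other marked pairs of the first bijection, only the index `i` of
-- the first one met satisfies the condition after the swap. If it carries none, no `i` does: the
-- swap would merge the cycle with that of `a i`, which carries the pair `i`.
open Classical in
lemma sum_pairWeight_first [Fintype ι] (c : A → B → R) (ha : a.Injective) (j : ι) :
    ∑ p : (A ≃ B) × (A ≃ B) with IsFirstOnly adj a b j p, pairWeight c p =
    ∑ p : (A ≃ B) × (A ≃ B) with IsFirstOnly adj a b j p ∧
        ∀ t ≠ j, (ratio p).SameCycle (a j) (a t) → p.1 (a t) ≠ b t, pairWeight c p +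
    ∑ i ∈ Finset.univ.erase j,
      ∑ p : (A ≃ B) × (A ≃ B) with IsFirstOnly adj a b j p ∧ p.1 (a i) = b i ∧
        ∀ t ≠ j, (Equiv.swap (a j) (a i) * ratio p).SameCycle (a j) (a t) → p.1 (a t) ≠ b t,
      pairWeight c p := by
  simp only [Finset.sum_filter]
  rw [Finset.sum_comm, ← Finset.sum_add_distrib]
  refine Finset.sum_congr rfl fun p _ => ?_
  by_cases hp : IsFirstOnly adj a b j p
  · simp only [hp, true_and, if_true]
    by_cases hn : ∀ t ≠ j, (ratio p).SameCycle (a j) (a t) → p.1 (a t) ≠ b t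
    · rw [if_pos hn, Finset.sum_eq_zero, add_zero]
      intro i hi
      have hij := Finset.ne_of_mem_erase hi
      refine if_neg fun ⟨h1, h2⟩ => ?_
      refine h2 i hij (Equiv.Perm.sameCycle_swap_mul_of_not_sameCycle fun h => ?_) h1
      exact hn i hij h h1
    · rw [if_neg hn, zero_add]
      push Not at hn
      obtain ⟨t, htj, hts, htb⟩ := hn
      obtain ⟨y, ⟨⟨i, ⟨hij, hib⟩, rfl⟩, hy⟩, huniq⟩ := Equiv.Perm.existsUnique_first_on_cycle
        (ρ := ratio p) (x := a j) (T := a '' {i | i ≠ j ∧ p.1 (a i) = b i})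
        (by rintro ⟨i, ⟨hij, -⟩, h⟩; exact hij (ha h)) ⟨a t, ⟨t, ⟨htj, htb⟩, rfl⟩, hts⟩
      rw [Finset.sum_eq_single_of_mem i (by simp [hij])]
      · rw [if_pos ⟨hib, fun t ht hs hb => hy (a t) ⟨t, ⟨ht, hb⟩, rfl⟩ hs⟩]
      · intro i' hi' hne
        refine if_neg fun ⟨h1, h2⟩ => hne (ha (huniq (a i') ⟨⟨i', ⟨?_, h1⟩, rfl⟩, ?_⟩))
        · exact Finset.ne_of_mem_erase hi'
        · rintro _ ⟨t, ⟨ht, hb⟩, rfl⟩ hs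
          exact h2 t ht hs hb
  · simp [hp]

lemma sum_mul_sum_filter (φ ψ : (A ≃ B) → Prop) [DecidablePred φ] [DecidablePred ψ]
    (F H : (A ≃ B) → R) :
    (∑ P with φ P, F P) * ∑ Q with ψ Q, H Q =
      ∑ p : (A ≃ B) × (A ≃ B) with φ p.1 ∧ ψ p.2, F p.1 * H p.2 := by
  rw [Finset.sum_mul_sum, ← Finset.sum_product', ← Finset.filter_product, Finset.univ_product_univ]

open Classical in
/-- The condensation identity for weighted bijections. -/
theorem condensation_of_bijections [Fintype ι] (c : A → B → R) (ha : a.Injective)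
    (hb : b.Injective) (hab : ∀ t, adj (a t) (b t))
    (hopp : NoOpposite adj a b) (hvirt : NoVirtual adj a b) (j : ι) :
    (∑ P : A ≃ B with ∀ u, adj u (P u), ∏ u, c u (P u)) *
        ∑ Q : A ≃ B with (∀ u, adj u (Q u)) ∧ ∀ t, Q (a t) ≠ b t, ∏ u, c u (Q u) =
      (∑ P : A ≃ B with (∀ u, adj u (P u)) ∧ P (a j) ≠ b j, ∏ u, c u (P u)) *
        (∑ Q : A ≃ B with (∀ u, adj u (Q u)) ∧ ∀ t ≠ j, Q (a t) ≠ b t, ∏ u, c u (Q u)) +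
      ∑ i ∈ Finset.univ.erase j, c (a i) (b i) * c (a j) (b j) *
        (∑ P : A ≃ B with P (a i) = b j ∧ ∀ u ≠ a i, adj u (P u), ∏ u ∈ {a i}ᶜ, c u (P u)) *
        ∑ Q : A ≃ B with Q (a j) = b i ∧ (∀ u ≠ a j, adj u (Q u)) ∧ ∀ t, Q (a t) ≠ b t,
          ∏ u ∈ {a j}ᶜ, c u (Q u) := by
  have hR : ∑ i ∈ Finset.univ.erase j, c (a i) (b i) * c (a j) (b j) *
        (∑ P : A ≃ B with P (a i) = b j ∧ ∀ u ≠ a i, adj u (P u), ∏ u ∈ {a i}ᶜ, c u (P u)) *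
        ∑ Q : A ≃ B with Q (a j) = b i ∧ (∀ u ≠ a j, adj u (Q u)) ∧ ∀ t, Q (a t) ≠ b t,
          ∏ u ∈ {a j}ᶜ, c u (Q u) = ∑ i ∈ Finset.univ.erase j,
      ∑ p : (A ≃ B) × (A ≃ B) with IsFirstOnly adj a b j p ∧ p.1 (a i) = b i ∧
        ∀ t ≠ j, (Equiv.swap (a j) (a i) * ratio p).SameCycle (a j) (a t) → p.1 (a t) ≠ b t,
      pairWeight c p := by
    refine Finset.sum_congr rfl fun i hi => ?_
    rw [sum_pairWeight_swap_virtual c ha hb hab hopp hvirt (Finset.ne_of_mem_erase hi), mul_assoc,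
      sum_mul_sum_filter, Finset.mul_sum]
  have hw : ∀ p : (A ≃ B) × (A ≃ B), (∏ u, c u (p.1 u)) * ∏ u, c u (p.2 u) = pairWeight c p :=
    fun p => Finset.prod_mul_distrib.symm
  have hL := sum_pairWeight_first (adj := adj) (b := b) c ha j
  rw [← sum_pairWeight_swap_single c hopp j] at hL
  rw [hR, sum_mul_sum_filter, sum_mul_sum_filter]
  simp only [hw]
  -- Both products are split, by `p.1 (a j) = b j` here and by `p.2 (a j) = b j` in `h2`; their
  -- second summands agree and cancel.
  have h1 : ∑ p : (A ≃ B) × (A ≃ B) with (∀ u, adj u (p.1 u)) ∧ (∀ u, adj u (p.2 u)) ∧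
        ∀ t, p.2 (a t) ≠ b t, pairWeight c p =
      ∑ p : (A ≃ B) × (A ≃ B) with IsFirstOnly adj a b j p, pairWeight c p +
      ∑ p : (A ≃ B) × (A ≃ B) with (∀ u, adj u (p.1 u) ∧ adj u (p.2 u)) ∧ p.1 (a j) ≠ b j ∧
        ∀ t, p.2 (a t) ≠ b t, pairWeight c p := by
    simp only [Finset.sum_filter]
    rw [← Finset.sum_add_distrib]
    refine Finset.sum_congr rfl fun p _ => ?_
    by_cases h : p.1 (a j) = b j <;> simp [h, IsFirstOnly, forall_and, and_assoc]
  have h2 : ∑ p : (A ≃ B) × (A ≃ B) with ((∀ u, adj u (p.1 u)) ∧ p.1 (a j) ≠ b j) ∧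
        (∀ u, adj u (p.2 u)) ∧ ∀ t ≠ j, p.2 (a t) ≠ b t, pairWeight c p =
      ∑ p : (A ≃ B) × (A ≃ B) with (∀ u, adj u (p.1 u) ∧ adj u (p.2 u)) ∧ p.1 (a j) ≠ b j ∧
        p.2 (a j) = b j ∧ ∀ t ≠ j, p.2 (a t) ≠ b t, pairWeight c p +
      ∑ p : (A ≃ B) × (A ≃ B) with (∀ u, adj u (p.1 u) ∧ adj u (p.2 u)) ∧ p.1 (a j) ≠ b j ∧
        ∀ t, p.2 (a t) ≠ b t, pairWeight c p := by
    simp only [Finset.sum_filter]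
    rw [← Finset.sum_add_distrib]
    refine Finset.sum_congr rfl fun p _ => ?_
    by_cases h : p.2 (a j) = b j
    · have hall : ¬ ∀ t, p.2 (a t) ≠ b t := fun h' => h' j h
      simp only [h, hall, forall_and]
      simp [and_assoc, and_left_comm]
    · have hall : (∀ t, p.2 (a t) ≠ b t) ↔ ∀ t ≠ j, p.2 (a t) ≠ b t :=
        ⟨fun h' t _ => h' t, fun h' t => by
          by_cases htj : t = j
          exacts [htj ▸ h, h' t htj]⟩
      simp only [h, hall, forall_and]
      simp [and_assoc, and_left_comm]
  rw [h1, h2, hL]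
  ring

end Counting

/-! ### Planarity restricts the cycles of a superposition -/

section Walks

variable {W : Type*} {G : SimpleGraph W} {U V : Set W}

lemma JoinedInside.mono {S T : Set W} {x y : W} (h : JoinedInside G S x y) (hST : S ⊆ T) :
    JoinedInside G T x y := by
  obtain ⟨p, hp⟩ := h
  exact ⟨p, fun v hv => hST (hp v hv)⟩

/-- Consecutive iterates share a neighbour: the partner of one under the second bijection is the
partner of the next under the first. -/
lemma fst_iterate_ratio_succ (p : (U ≃ V) × (U ≃ V)) (x : U) (i : ℕ) :
    p.1 ((ratio p)^[i + 1] x) = p.2 ((ratio p)^[i] x) := by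
  rw [Function.iterate_succ_apply', fst_ratio_apply]

/-- The walk in the superposition of two bijections between two vertices of the first colour
class. -/
lemma joinedInside_iterate_ratio (p : (U ≃ V) × (U ≃ V)) (x : U) {l m : ℕ} (hlm : l ≤ m)
    (h : ∀ i, l ≤ i → i < m →
      G.Adj ((ratio p)^[i] x : U) (p.2 ((ratio p)^[i] x) : V) ∧
      G.Adj ((ratio p)^[i + 1] x : U) (p.1 ((ratio p)^[i + 1] x) : V)) :
    JoinedInside G {w | (∃ i, l ≤ i ∧ i ≤ m ∧ ((ratio p)^[i] x : U) = w) ∨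
      ∃ i, l ≤ i ∧ i < m ∧ (p.2 ((ratio p)^[i] x) : W) = w}
      ((ratio p)^[l] x : U) ((ratio p)^[m] x : U) := by
  induction m, hlm using Nat.le_induction with
  | base => exact .refl (Or.inl ⟨l, le_rfl, le_rfl, rfl⟩)
  | succ m hm ih =>
    obtain ⟨h1, h2⟩ := h m hm (Nat.lt_succ_self m)
    rw [fst_iterate_ratio_succ] at h2
    have m1 := (Or.inr ⟨m, hm, Nat.lt_succ_self m, rfl⟩ :
      (∃ i, l ≤ i ∧ i ≤ m + 1 ∧ ((ratio p)^[i] x : W) = (p.2 ((ratio p)^[m] x) : W)) ∨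
      ∃ i, l ≤ i ∧ i < m + 1 ∧ (p.2 ((ratio p)^[i] x) : W) = (p.2 ((ratio p)^[m] x) : W))
    refine ((ih fun i hi hi' => h i hi (by omega)).mono ?_).trans
      ((JoinedInside.of_adj h1 (Or.inl ⟨m, hm, by omega, rfl⟩) m1).trans
        (JoinedInside.of_adj h2.symm m1 (Or.inl ⟨m + 1, by omega, le_rfl, rfl⟩)))
    rintro w (⟨i, hi, hi', h⟩ | ⟨i, hi, hi', h⟩)
    exacts [Or.inl ⟨i, hi, by omega, h⟩, Or.inr ⟨i, hi, by omega, h⟩]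

/-- The walk in the superposition of two bijections between two vertices of the second colour
class. -/
lemma joinedInside_snd_iterate_ratio (p : (U ≃ V) × (U ≃ V)) (x : U) {l m : ℕ} (hlm : l ≤ m)
    (h : ∀ i, l < i → i ≤ m →
      G.Adj ((ratio p)^[i] x : U) (p.1 ((ratio p)^[i] x) : V) ∧
      G.Adj ((ratio p)^[i] x : U) (p.2 ((ratio p)^[i] x) : V)) :
    JoinedInside G {w | (∃ i, l < i ∧ i ≤ m ∧ ((ratio p)^[i] x : U) = w) ∨
      ∃ i, l ≤ i ∧ i ≤ m ∧ (p.2 ((ratio p)^[i] x) : W) = w}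
      (p.2 ((ratio p)^[l] x) : V) (p.2 ((ratio p)^[m] x) : V) := by
  induction m, hlm using Nat.le_induction with
  | base => exact .refl (Or.inr ⟨l, le_rfl, le_rfl, rfl⟩)
  | succ m hm ih =>
    obtain ⟨h1, h2⟩ := h (m + 1) (by omega) le_rfl
    rw [fst_iterate_ratio_succ] at h1
    have m1 := (Or.inl ⟨m + 1, by omega, le_rfl, rfl⟩ :
      (∃ i, l < i ∧ i ≤ m + 1 ∧ ((ratio p)^[i] x : W) = ((ratio p)^[m + 1] x : W)) ∨
      ∃ i, l ≤ i ∧ i ≤ m + 1 ∧ (p.2 ((ratio p)^[i] x) : W) = ((ratio p)^[m + 1] x : W))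
    refine ((ih fun i hi hi' => h i hi (by omega)).mono ?_).trans
      ((JoinedInside.of_adj h1.symm (Or.inr ⟨m, hm, by omega, rfl⟩) m1).trans
        (JoinedInside.of_adj h2 m1 (Or.inr ⟨m + 1, by omega, le_rfl, rfl⟩)))
    rintro w (⟨i, hi, hi', h⟩ | ⟨i, hi, hi', h⟩)
    exacts [Or.inl ⟨i, hi, by omega, h⟩, Or.inr ⟨i, hi, by omega, h⟩]

lemma iterate_eq_of_lt_minimalPeriod {A : Type*} {ρ : Equiv.Perm A} {x : A} {i j : ℕ}
    (hi : i < Function.minimalPeriod ρ x) (hj : j < Function.minimalPeriod ρ x)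
    (h : ρ^[i] x = ρ^[j] x) : i = j :=
  Function.iterate_injOn_Iio_minimalPeriod hi hj h

lemma exists_lt_minimalPeriod {A : Type*} [Finite A] {ρ : Equiv.Perm A} {x y : A}
    (h : ρ.SameCycle x y) : ∃ m < Function.minimalPeriod ρ x, ρ^[m] x = y :=
  (Equiv.Perm.sameCycle_iff_exists_lt_of_iterate_eq (Equiv.Perm.minimalPeriod_pos ρ x)
    Function.iterate_minimalPeriod).1 h

variable {ι : Type*} {a : ι → U} {b : ι → V} [Finite U]

/-- If disjoint walks never join `a i` to `a j` and `b i` to `b j`, then no cycle in the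
superposition of two perfect matchings traverses two of the edges `a i`, `b i` in opposite
directions. -/
lemma noOpposite_of_not_joinedInside (hUV : Disjoint U V)
    (hcross : ∀ i j, i ≠ j → ∀ S T : Set W, Disjoint S T → JoinedInside G S (a i) (a j) →
      JoinedInside G T (b i) (b j) → False) :
    NoOpposite (fun (u : U) (v : V) => G.Adj u v) a b := by
  intro i j hij p hadj hj hi hs
  have hd := Set.disjoint_left.1 hUV
  have hN := Equiv.Perm.minimalPeriod_pos (ratio p) (a j)
  have hper : (ratio p)^[Function.minimalPeriod (ratio p) (a j)] (a j) = a j :=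
    Function.iterate_minimalPeriod
  obtain ⟨m, hm, hmi⟩ := exists_lt_minimalPeriod hs
  have hinj := fun {i i' : ℕ} => iterate_eq_of_lt_minimalPeriod (ρ := ratio p) (x := a j)
    (i := i) (j := i')
  set N := Function.minimalPeriod (ratio p) (a j)
  have h1 := joinedInside_iterate_ratio (G := G) p (a j) (Nat.zero_le m)
    fun i _ _ => ⟨(hadj _).2, (hadj _).1⟩
  have h2 := joinedInside_snd_iterate_ratio (G := G) p (a j) (l := m) (m := N - 1) (by omega)
    fun i _ _ => hadj _
  rw [hmi, hi, ← fst_iterate_ratio_succ, Nat.sub_add_cancel hN, hper, hj] at h2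
  rw [hmi] at h1
  -- The first walk uses the iterates `0, …, m` and the partners of `0, …, m - 1`, the second one
  -- the remaining iterates and partners of the period.
  refine hcross j i hij.symm _ _ (Set.disjoint_left.2 ?_) h1 h2.symm
  rintro w (⟨l, -, hl, rfl⟩ | ⟨l, -, hl, rfl⟩) (⟨l', hl', hl'', h⟩ | ⟨l', hl', hl'', h⟩)
  · have := hinj (by omega) (by omega) (Subtype.ext h)
    omega
  · exact hd (Subtype.coe_prop ((ratio p)^[l] (a j))) (h ▸ Subtype.coe_prop (p.2 _))
  · exact hd (Subtype.coe_prop ((ratio p)^[l'] (a j))) (h ▸ Subtype.coe_prop (p.2 _))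
  · have := hinj (by omega) (by omega) (p.2.injective (Subtype.ext h))
    omega

/-- If disjoint walks never join `a i` to `a j` and `b i` to `b j`, then the superposition of two
near-perfect matchings that miss `a i`, `b j` and `a j`, `b i`, respectively, has no
path from `a i` to `a j`. -/
lemma noVirtual_of_not_joinedInside (hUV : Disjoint U V) (ha : a.Injective)
    (hcross : ∀ i j, i ≠ j → ∀ S T : Set W, Disjoint S T → JoinedInside G S (a i) (a j) →
      JoinedInside G T (b i) (b j) → False) :
    NoVirtual (fun (u : U) (v : V) => G.Adj u v) a b := by
  intro i j hij p hP hQ hi hj hs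
  have hd := Set.disjoint_left.1 hUV
  have hN := Equiv.Perm.minimalPeriod_pos (ratio p) (a j)
  have hper : (ratio p)^[Function.minimalPeriod (ratio p) (a j)] (a j) = a j :=
    Function.iterate_minimalPeriod
  obtain ⟨m, hm, hmi⟩ := exists_lt_minimalPeriod hs
  have hinj := fun {i i' : ℕ} => iterate_eq_of_lt_minimalPeriod (ρ := ratio p) (x := a j)
    (i := i) (j := i')
  set N := Function.minimalPeriod (ratio p) (a j)
  have hm0 : 0 < m := by
    rcases Nat.eq_zero_or_pos m with rfl | h
    · exact absurd (ha hmi).symm hij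
    · exact h
  have hne_i : ∀ l < N, l ≠ m → (ratio p)^[l] (a j) ≠ a i := fun l hl hlm h =>
    hlm (hinj hl hm (h.trans hmi.symm))
  have hne_j : ∀ l < N, 0 < l → (ratio p)^[l] (a j) ≠ a j := fun l hl hl0 h =>
    hl0.ne' (hinj (i' := 0) hl hN h)
  -- The virtual edges sit at iterate `0` for the second bijection and at iterate `m` for the first.
  -- The walk from `m` to `N` therefore avoids both; its last vertex, iterate `N`, is `a j` again.
  have h1 := joinedInside_iterate_ratio (G := G) p (a j) hm.le fun l hl hl' =>
    ⟨hQ _ (hne_j l hl' (by omega)), hP _ (by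
      rcases Nat.lt_or_ge (l + 1) N with h | h
      · exact hne_i _ h (by omega)
      · rw [show l + 1 = N by omega, hper]; exact fun h => hij (ha h).symm)⟩
  have h2 := joinedInside_snd_iterate_ratio (G := G) p (a j) (Nat.zero_le (m - 1))
    fun l hl hl' => ⟨hP _ (hne_i l (by omega) (by omega)), hQ _ (hne_j l (by omega) hl)⟩
  rw [← fst_iterate_ratio_succ p _ (m - 1), Nat.sub_add_cancel hm0, hmi, hi] at h2
  simp only [Function.iterate_zero, id] at h2
  rw [hj] at h2
  rw [hmi, hper] at h1
  refine hcross i j hij _ _ (Set.disjoint_left.2 ?_) h1 h2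
  rintro w (⟨l, hlm, hl, rfl⟩ | ⟨l, hlm, hl, rfl⟩) (⟨l', hl', hl'', h⟩ | ⟨l', hl', hl'', h⟩)
  -- Iterate `N` lies outside the range of injectivity, but it equals `a j`, and the other walk uses
  -- only iterates from `1` on.
  · rcases hl.lt_or_eq with hl | rfl
    · have := hinj (by omega) (by omega) (Subtype.ext h)
      omega
    · exact hne_j l' (by omega) hl' ((Subtype.ext h).trans hper)
  · exact hd (Subtype.coe_prop ((ratio p)^[l] (a j))) (h ▸ Subtype.coe_prop (p.2 _))
  · exact hd (Subtype.coe_prop ((ratio p)^[l'] (a j))) (h ▸ Subtype.coe_prop (p.2 _))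
  · have := hinj (by omega) (by omega) (p.2.injective (Subtype.ext h))
    omega

end Walks

/-! ### Translation to matching sums of subgraphs -/

theorem corollary3p4 {W R : Type*} [Fintype W] [CommRing R]
    (G : SimpleGraph W) (D : PlaneDrawing G) (ω : Sym2 W → R)
    (U V : Set W) (n : ℕ) (hUV : U ∪ V = Set.univ) (hG : G.IsBipartiteWith U V)
    (hU : U.ncard = n) (hV : V.ncard = n)
    (k : ℕ) (hk : 2 ≤ k) (hkn : k ≤ n)
    (a b : Fin k → W) (hab : ∀ i, G.Adj (a i) (b i))
    (hindep : Pairwise fun i j => Disjoint ({a i, b i} : Set W) {a j, b j})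
    (f : Set ℂ) (hf : D.IsFace f)
    (hbd : ∀ i, D.EdgeOnBoundary f ⟨(a i, b i), hab i⟩)
    (hcyc : D.InCyclicOrder f (alternating a b))
    (hA : ∀ i, a i ∈ U) (hB : ∀ i, b i ∈ V)
    (e : Fin k → Sym2 W) (he : ∀ i, e i = s(a i, b i)) (j : Fin k) :
    matchingSum ω (⊤ : G.Subgraph) *
        matchingSum ω ((⊤ : G.Subgraph).deleteEdges (Set.range e)) =
      matchingSum ω ((⊤ : G.Subgraph).deleteEdges {e j}) *
          matchingSum ω ((⊤ : G.Subgraph).deleteEdges (e '' {j}ᶜ)) +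
        ∑ i ∈ Finset.univ.erase j,
          ω (e i) * ω (e j) *
            matchingSum ω ((⊤ : G.Subgraph).deleteVerts {a i, b j}) *
            matchingSum ω
              (((⊤ : G.Subgraph).deleteVerts {a j, b i}).deleteEdges (e '' {i, j}ᶜ)) := by
  classical
  have hd := Set.disjoint_left.1 hG.disjoint
  have hane : ∀ i t, i ≠ t → a i ≠ a t := fun i t hit h =>
    Set.disjoint_left.1 (hindep hit) (Set.mem_insert _ _) (h ▸ Set.mem_insert _ _)
  have hbne : ∀ i t, i ≠ t → b i ≠ b t := fun i t hit h =>
    Set.disjoint_left.1 (hindep hit) (Set.mem_insert_of_mem _ rfl)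
      (h ▸ Set.mem_insert_of_mem _ rfl)
  let a' : Fin k → U := fun i => ⟨a i, hA i⟩
  let b' : Fin k → V := fun i => ⟨b i, hB i⟩
  have ha' : a'.Injective := fun i t h => by
    by_contra hit
    exact hane i t hit (congrArg Subtype.val h)
  have hb' : b'.Injective := fun i t h => by
    by_contra hit
    exact hbne i t hit (congrArg Subtype.val h)
  have hcross : ∀ i j, i ≠ j → ∀ S T : Set W, Disjoint S T → JoinedInside G S (a' i) (a' j) →
      JoinedInside G T (b' i) (b' j) → False := fun i j hij S T hST hS hT =>
    D.not_joinedInside_alternating hf hcyc hij hST hS hT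
  have hcard : Fintype.card U = Fintype.card V := by
    rw [← Nat.card_eq_fintype_card, ← Nat.card_eq_fintype_card, Nat.card_coe_set_eq,
      Nat.card_coe_set_eq, hU, hV]
  have he' : ∀ (u : U) (v : V) t, s((u : W), (v : W)) = e t ↔ u = a' t ∧ v = b' t := by
    intro u v t
    rw [he]
    exact ⟨fun h => sym2_inj_of_disjoint (u' := a' t) (v' := b' t) hG.disjoint h,
      fun ⟨h1, h2⟩ => by rw [h1, h2]⟩
  -- the matching sums of the subgraphs with all vertices
  have hfull : ∀ T : Set (Fin k), matchingSum ω ((⊤ : G.Subgraph).deleteEdges (e '' T)) =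
      ∑ P : U ≃ V with (∀ u : U, G.Adj (u : W) (P u : W)) ∧ ∀ t ∈ T, P (a' t) ≠ b' t,
        ∏ u : U, ω s((u : W), (P u : W)) := by
    intro T
    -- No vertex is deleted, so the prescribed map is arbitrary.
    rw [matchingSum_eq_sum_equiv ω hUV hG hcard _ ∅ (fun _ => b' j) (by simp) (by simp)]
    simp only [Finset.compl_empty]
    refine Finset.sum_congr (Finset.filter_congr fun P _ => ?_) fun _ _ => rfl
    simp only [Finset.notMem_empty, false_imp_iff, implies_true, true_and, not_false_eq_true,
      true_imp_iff, SimpleGraph.Subgraph.deleteEdges_adj, SimpleGraph.Subgraph.top_adj,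
      forall_and, Set.mem_image, not_exists, not_and]
    refine and_congr_right fun _ => ⟨fun h t ht hP => h (a' t) t ht ?_, fun h u t ht hP => ?_⟩
    · exact ((he' _ _ t).2 ⟨rfl, hP⟩).symm
    · obtain ⟨rfl, h2⟩ := (he' _ _ t).1 hP.symm
      exact h t ht h2
  -- the matching sums of the subgraphs with two deleted vertices
  have hmiss : ∀ x y : Fin k, ∀ T : Set (Fin k), x ∉ T →
      matchingSum ω (((⊤ : G.Subgraph).deleteVerts {a x, b y}).deleteEdges (e '' T)) =
      ∑ P : U ≃ V with P (a' x) = b' y ∧ (∀ u : U, u ≠ a' x → G.Adj (u : W) (P u : W)) ∧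
          ∀ t ∈ T, P (a' t) ≠ b' t,
        ∏ u ∈ ({a' x} : Finset U)ᶜ, ω s((u : W), (P u : W)) := by
    intro x y T hxT
    have hmem : ∀ u : U, (u : W) ∉ ({a x, b y} : Set W) ↔ u ≠ a' x := by
      intro u
      simp only [Set.mem_insert_iff, Set.mem_singleton_iff, not_or]
      exact ⟨fun h h' => h.1 (congrArg Subtype.val h'), fun h =>
        ⟨fun h' => h (Subtype.ext h'), fun h' => hd u.2 (h' ▸ hB y)⟩⟩
    have hmem' : ∀ v : V, (v : W) ∉ ({a x, b y} : Set W) ↔ v ≠ b' y := by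
      intro v
      simp only [Set.mem_insert_iff, Set.mem_singleton_iff, not_or]
      exact ⟨fun h h' => h.2 (congrArg Subtype.val h'), fun h =>
        ⟨fun h' => hd (hA x) (h' ▸ v.2), fun h' => h (Subtype.ext h')⟩⟩
    -- Deleting `a x` and `b y` amounts to prescribing the virtual pair and omitting its weight.
    rw [matchingSum_eq_sum_equiv ω hUV hG hcard _ {a' x} (fun _ => b' y) (by simp)
      (by intro w; simp [a', b', eq_comm])]
    refine Finset.sum_congr (Finset.filter_congr fun P _ => ?_) fun _ _ => rfl
    simp only [Finset.mem_singleton, forall_eq, SimpleGraph.Subgraph.deleteEdges_adj,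
      SimpleGraph.Subgraph.deleteVerts_adj, SimpleGraph.Subgraph.top_adj,
      SimpleGraph.Subgraph.verts_top, Set.mem_univ, true_and, Set.mem_image, not_exists, not_and,
      hmem, hmem']
    refine and_congr_right fun hPx => ⟨fun h => ⟨fun u hu => (h u hu).1.2.2, fun t ht hP => ?_⟩,
      fun h u hu => ⟨⟨hu, fun h' => hu (P.injective (h'.trans hPx.symm)), h.1 u hu⟩,
        fun t ht hP => ?_⟩⟩
    · exact (h (a' t) fun h' => hxT (ha' h' ▸ ht)).2 t ht ((he' _ _ t).2 ⟨rfl, hP⟩).symm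
    · obtain ⟨rfl, h2⟩ := (he' _ _ t).1 hP.symm
      exact h.2 t ht h2
  have key := condensation_of_bijections (fun (u : U) (v : V) => ω s((u : W), (v : W))) ha' hb'
    hab (noOpposite_of_not_joinedInside hG.disjoint hcross)
    (noVirtual_of_not_joinedInside hG.disjoint ha' hcross) j
  have e0 := hfull ∅
  have e1 := hfull Set.univ
  have e2 := hfull {j}
  have e3 := hfull {j}ᶜ
  rw [Set.image_empty, SimpleGraph.Subgraph.deleteEdges_empty_eq] at e0
  rw [Set.image_univ] at e1
  rw [Set.image_singleton] at e2
  rw [e0, e1, e2, e3]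
  simp only [Set.mem_empty_iff_false, false_imp_iff, implies_true, and_true, Set.mem_univ,
    true_imp_iff, Set.mem_singleton_iff, forall_eq, Set.mem_compl_iff]
  have hsum : ∀ i ∈ Finset.univ.erase j, ω (e i) * ω (e j) *
      matchingSum ω ((⊤ : G.Subgraph).deleteVerts {a i, b j}) *
      matchingSum ω (((⊤ : G.Subgraph).deleteVerts {a j, b i}).deleteEdges (e '' {i, j}ᶜ)) =
      ω s((a' i : W), (b' i : W)) * ω s((a' j : W), (b' j : W)) *
      (∑ P : U ≃ V with P (a' i) = b' j ∧ ∀ u ≠ a' i, G.Adj (u : W) (P u : W),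
        ∏ u ∈ ({a' i} : Finset U)ᶜ, ω s((u : W), (P u : W))) *
      ∑ Q : U ≃ V with Q (a' j) = b' i ∧ (∀ u ≠ a' j, G.Adj (u : W) (Q u : W)) ∧
        ∀ t, Q (a' t) ≠ b' t, ∏ u ∈ ({a' j} : Finset U)ᶜ, ω s((u : W), (Q u : W)) := by
    intro i hi
    have hij := Finset.ne_of_mem_erase hi
    have m1 := hmiss i j ∅ (by simp)
    rw [Set.image_empty, SimpleGraph.Subgraph.deleteEdges_empty_eq] at m1
    rw [m1, hmiss j i _ (by simp), he i, he j]
    simp only [Set.mem_empty_iff_false, false_imp_iff, implies_true, and_true]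
    congr 1
    refine Finset.sum_congr ?_ fun _ _ => rfl
    ext P
    simp only [Finset.mem_filter, Finset.mem_univ, true_and]
    refine and_congr_right fun hPj => and_congr_right fun _ =>
      ⟨fun h t ht => ?_, fun h t _ => h t⟩
    -- For `t = i` and `t = j` the condition is automatic, since the virtual pair already occupies
    -- `b i` and `a j`.
    by_cases htj : t = j
    · subst htj
      exact hij (hb' (hPj.symm.trans ht))
    by_cases hti : t = i
    · subst hti
      exact htj (ha' (P.injective (ht.trans hPj.symm)))
    · exact h t (by simp [hti, htj]) ht
  rw [Finset.sum_congr rfl hsum]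
  convert! key
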